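/- Let $\mathbb R^{1+3}$ carry the Minkowski inner product $(X,Y)_m=-X^0Y^0+\sum_{i=1}^3X^iY^i$. A periodic admissible couple is a pair $(\gamma_0,v_0)$ with $\gamma_0\in C^1(\mathbb R;\mathbb R^3)$, $\gamma_0'\neq 0$ everywhere, $v_0\in C^0(\mathbb R;\mathbb R^3)$, $v_0\cdot\gamma_0'=0$ and $|v_0|<1$ everywhere, such that $\gamma_0$ and $v_0$ are periodic with a common period. Two couples are equivalent if they differ by a $C^1$ diffeomorphism $\lambda$ of $\mathbb R$, i.e. $(\gamma_0,v_0)=(\hat\gamma_0,\hat v_0)\circ\lambda$. The $X$-topology on couples is the one pulled back from the set of equivalence classes, which carries the quotient of the $C^1\times C^0$ topology (uniform convergence on $\mathbb R$ of $\gamma_0,\gamma_0',v_0$); thus its open sets are exactly the sets of couples that are invariant under equivalence and open in the $C^1\times C^0$ topology. A couple $(\gamma_0,v_0)$ is called extendable if $\gamma_0$ can be immersed in a global timelike extremal cylinder tangent to $(1,v_0)$, that is, if there is a $C^1$ map $\gamma:\mathbb R\times\mathbb R\to\mathbb R^3$ and $E>0$ with $\gamma(t,x+E)=\gamma(t,x)$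 for all $t,x$, such that $\psi(t,x)=(t,\gamma(t,x))$ satisfies: (i) $\psi$ is timelike: $g:=\det\big((\partial_i\psi,\partial_j\psi)_m\big)<0$ everywhere (so $\psi$ is an immersion); (ii) $\psi$ is extremal: it is a critical point of the Minkowskian area $\int\sqrt{|g|}$ with respect to compactly supported $C^1$ variations; (iii) $\gamma(0,x)=\gamma_0(x)$, and $(1,v_0(x))$ lies in the tangent plane $d\psi_{(0,x)}(\mathbb R^2)$, for all $x\in\mathbb R$. Let $\mathcal O$ be the set of extendable periodic admissible couples and $\mathcal N$ the set of non-extendable ones, with the $X$-topology. Then: 1. $\mathcal O$ is open: if $(\gamma_0,v_0)$ is extendable, so is every periodic admissible couple sufficiently close to it. 2. Generically, non-extendability is stable as well: there is a closed set $S\subseteq\mathcal N$ with empty interior, such that moreover $\mathcal N\setminus S$ is dense in $\mathcal N$, and such that for every $(\gamma_0,v_0)\in\mathcal N\setminus S$ all periodic admissible couples sufficiently close to $(\gamma_0,v_0)$ are non-extendable. In particular every neighbourhood of a non-extendable couple contains a nonempty open set of non-extendable couples. 3. Both $\mathcal O$ and $\mathcal N$ have nonempty interior. -/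

import Mathlib

open Set Topology MeasureTheory

noncomputable section

namespace ExtremalCylinder

/-- Euclidean space `ℝⁿ`. -/
abbrev Space (n : ℕ) : Type := EuclideanSpace ℝ (Fin n)

/-- Minkowski space `ℝ^{1+n}`; the first component is time. -/
abbrev Minkowski (n : ℕ) : Type := ℝ × Space n

variable {n : ℕ}

/-- The Minkowski inner product, with signature `(-, +, …, +)`. -/
def minkowskiInner (X Y : Minkowski n) : ℝ :=
  -(X.1 * Y.1) + inner ℝ X.2 Y.2

/-- `∂ψ/∂t` for a map `ψ` of the variables `(t, x)`. -/
def partialT (ψ : ℝ × ℝ → Minkowski n) (z : ℝ × ℝ) : Minkowski n :=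
  fderiv ℝ ψ z (1, 0)

/-- `∂ψ/∂x` for a map `ψ` of the variables `(t, x)`. -/
def partialX (ψ : ℝ × ℝ → Minkowski n) (z : ℝ × ℝ) : Minkowski n :=
  fderiv ℝ ψ z (0, 1)

/-- `g = det (g_{ij})`, where `g_{ij} = (∂ᵢψ, ∂ⱼψ)` is the induced metric. -/
def metricDet (ψ : ℝ × ℝ → Minkowski n) (z : ℝ × ℝ) : ℝ :=
  minkowskiInner (partialT ψ z) (partialT ψ z) * minkowskiInner (partialX ψ z) (partialX ψ z)
    - minkowskiInner (partialT ψ z) (partialX ψ z) * minkowskiInner (partialX ψ z) (partialT ψ z)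

/-- The Minkowskian area `∫_U √|g|` of `ψ(U)`. -/
def minkowskiArea (ψ : ℝ × ℝ → Minkowski n) (U : Set (ℝ × ℝ)) : ℝ :=
  ∫ z in U, Real.sqrt |metricDet ψ z|

/-- `ψ` is timelike: `g < 0` everywhere. For a differentiable `ψ` this forces `∂ψ/∂t`, `∂ψ/∂x` to be
linearly independent, so that `ψ` is an immersion. -/
def IsTimelike (ψ : ℝ × ℝ → Minkowski n) : Prop :=
  ∀ z, metricDet ψ z < 0

/-- `ψ` is a critical point of the Minkowskian area with respect to compactly supported variations:
for every compactly supported `C¹` variation field `φ`, supported in the bounded open set `U`,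
the derivative at `s = 0` of the area of `(ψ + s φ)(U)` exists and vanishes. -/
def IsExtremal (ψ : ℝ × ℝ → Minkowski n) : Prop :=
  ∀ φ : ℝ × ℝ → Minkowski n, ContDiff ℝ 1 φ → HasCompactSupport φ →
    ∀ U : Set (ℝ × ℝ), IsOpen U → Bornology.IsBounded U → tsupport φ ⊆ U →
      HasDerivAt (fun s : ℝ => minkowskiArea (fun z => ψ z + s • φ z) U) 0 0

/-- The map `ψ(t, x) = (t, γ(t, x))`. -/
def graphMap (γ : ℝ × ℝ → Space n) (z : ℝ × ℝ) : Minkowski n := (z.1, γ z)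

/-- `γ` parametrizes, through `ψ(t, x) = (t, γ(t, x))` with `(t, x) ∈ ℝ × ℝ`, a global timelike
extremal cylinder: `γ` is `C¹`, all the maps `γ(t, ·)` have a common period, and `ψ` is a timelike
(hence immersed) extremal surface. -/
structure IsTimelikeExtremalCylinder (γ : ℝ × ℝ → Space n) : Prop where
  contDiff : ContDiff ℝ 1 γ
  periodic : ∃ E : ℝ, 0 < E ∧ ∀ t x : ℝ, γ (t, x + E) = γ (t, x)
  timelike : IsTimelike (graphMap γ)
  extremal : IsExtremal (graphMap γ)

/-- A periodic admissible couple `(γ₀, v₀)`: a `C¹` immersed curve `γ₀ : ℝ → ℝⁿ` and a continuous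
velocity field `v₀ : ℝ → ℝⁿ` with `v₀ · γ₀' = 0` and `|v₀| < 1`, with a common period. -/
structure PeriodicCouple (n : ℕ) where
  curve : ℝ → Space n
  velocity : ℝ → Space n
  contDiff_curve : ContDiff ℝ 1 curve
  continuous_velocity : Continuous velocity
  immersion : ∀ x, deriv curve x ≠ 0
  orthogonal : ∀ x, inner ℝ (velocity x) (deriv curve x) = 0
  subluminal : ∀ x, ‖velocity x‖ < 1
  periodic : ∃ L : ℝ, 0 < L ∧ Function.Periodic curve L ∧ Function.Periodic velocity L

namespace PeriodicCouple

/-- Two couples are equivalent if they differ by a `C¹` diffeomorphism `l` of `ℝ`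
(which may reverse the orientation). -/
def Equivalent (c d : PeriodicCouple n) : Prop :=
  ∃ l : ℝ ≃ ℝ, ContDiff ℝ 1 l ∧ ContDiff ℝ 1 l.symm ∧
    c.curve = d.curve ∘ l ∧ c.velocity = d.velocity ∘ l

theorem equivalent_equivalence : Equivalence (Equivalent (n := n)) where
  refl c := ⟨Equiv.refl ℝ, contDiff_id, contDiff_id, rfl, rfl⟩
  symm := by
    rintro c d ⟨l, h₁, h₂, h₃, h₄⟩
    refine ⟨l.symm, h₂, h₁, ?_, ?_⟩
    · funext x; simp [h₃]
    · funext x; simp [h₄]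
  trans := by
    rintro c d e ⟨l, h₁, h₂, h₃, h₄⟩ ⟨m, k₁, k₂, k₃, k₄⟩
    refine ⟨l.trans m, k₁.comp h₁, h₂.comp k₂, ?_, ?_⟩
    · funext x; simp [h₃, k₃]
    · funext x; simp [h₄, k₄]

/-- The setoid of reparametrization of couples. -/
def equivSetoid (n : ℕ) : Setoid (PeriodicCouple n) := ⟨Equivalent, equivalent_equivalence⟩

/-- The topology of uniform convergence on `ℝ` of `γ₀`, `γ₀'` and `v₀`
(the `C¹ × C⁰` topology on couples, before passing to equivalence classes). -/
@[reducible]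
def uniformTopology (n : ℕ) : TopologicalSpace (PeriodicCouple n) :=
  TopologicalSpace.induced
    (fun c => (UniformFun.ofFun c.curve, UniformFun.ofFun (deriv c.curve),
      UniformFun.ofFun c.velocity))
    inferInstance

/-- The quotient of the `C¹ × C⁰` topology on the set of equivalence classes of periodic
admissible couples. -/
@[reducible]
def classTopology (n : ℕ) : TopologicalSpace (Quotient (equivSetoid n)) :=
  TopologicalSpace.coinduced (Quotient.mk (equivSetoid n)) (uniformTopology n)

/-- The topology on couples which compares their equivalence classes: the open sets are the sets of
all couples whose class belongs to an open set of classes. -/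
instance xTopology (n : ℕ) : TopologicalSpace (PeriodicCouple n) :=
  TopologicalSpace.induced (Quotient.mk (equivSetoid n)) (classTopology n)

/-- The curve of the couple can be immersed in a global timelike extremal cylinder tangent to
`(1, v₀)`: there is such a cylinder `ψ(t, x) = (t, γ(t, x))` with `γ(0, ·) = γ₀` and with
`(1, v₀(x))` in the tangent plane (the range of `dψ`) at `(0, x)` for every `x`. -/
def Extendable (c : PeriodicCouple n) : Prop :=
  ∃ γ : ℝ × ℝ → Space n, IsTimelikeExtremalCylinder γ ∧
    (∀ x, γ (0, x) = c.curve x) ∧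
    ∀ x, ((1, c.velocity x) : Minkowski n) ∈ Set.range (fderiv ℝ (graphMap γ) (0, x))

end PeriodicCouple

end ExtremalCylinder

end

/-!
A couple `(γ₀, v₀)` is encoded by its two null directions `p = v₀ + τ` and `q = v₀ - τ`, where `τ` is
the vector tangent to the curve which makes `p` and `q` unit vectors (`PeriodicCouple.nullPlus`,
`PeriodicCouple.nullMinus`). Everything rests on the criterion `PeriodicCouple.extendable_iff`:
a couple is extendable if and only if `p x ≠ q y` for all `x` and `y`.

* If `p` and `q` never meet, then, in the energy parametrization of the curve, d'Alembert's formula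
  with the wave profiles `∫ p` and `∫ q` gives a surface whose metric determinant vanishes only where
  a value of `p` equals a value of `q`, so that the surface is timelike. It is extremal because its
  conserved currents are rotated gradients.
* Conversely, the first variation formula (`hasDerivAt_minkowskiArea`) shows that the currents
  `√|g| g^{ij} ∂ⱼψ` of a `C¹` extremal surface are divergence-free in the weak sense, hence have `C¹`
  potentials (`IsWeaklyDivFree.exists_potential`; the field is mollified to obtain them). The
  potential `X` of the time component is a conjugate of the time function, and `(t, X)` are global
  isothermal coordinates, thanks to the periodicity. In these coordinates one null velocity of the
  surface depends on `X + t` only and the other one on `X - t` only. Any value of `p` and any value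
  of `q` thus occur as the two null velocities at a common point of the surface, where they differ.

By periodicity the ranges of `p` and `q` are compact, so they remain disjoint under small
perturbations: extendability is open. Changes of parameter preserve `p` and `q` or exchange them,
so the open sets found are invariant under equivalence.

Non-extendability is stable at a couple whose null directions cross transversally on the sphere,
as two curves in a surface do: by the Poincaré–Miranda theorem, nearby curves still cross
(`meetStably_of_crossing`). Such couples are dense among the non-extendable ones
(`PeriodicCouple.exists_near_meetStably`): near a common value `e` of `p` and `q`, both are
replaced by small arcs of great circles through `e`, orthogonal to each other. The new null
directions determine a curve derivative, whose mean over a period is brought back to zero by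
a small correction away from the crossing. Hence the non-extendable couples lie in the closure of
the interior of their set, and the exceptional set `S` is the complement of that interior.

Finally, the two behaviours occur: the circle at rest has antipodal points with `p x = q y`, and
an explicit couple has null directions on two arcs of great circles which do not meet.
-/

noncomputable section

namespace ExtremalCylinder

/-! ### Crossing of curves -/

/-- A continuous angle whose sine stays positive cannot leave the interval `(0, π)`. -/
theorem mem_Ioo_of_sin_pos {f : ℝ → ℝ} {a b : ℝ} (hf : Continuous f)
    (hs : ∀ t ∈ Icc a b, 0 < Real.sin (f t)) {t₀ t₁ : ℝ} (h₀ : t₀ ∈ Icc a b) (h₁ : t₁ ∈ Icc a b)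
    (h : f t₀ ∈ Ioo 0 Real.pi) : f t₁ ∈ Ioo 0 Real.pi := by
  have hc : (f '' Icc a b).OrdConnected :=
    (isPreconnected_Icc.image f hf.continuousOn).ordConnected
  have m₀ := mem_image_of_mem f h₀
  have m₁ := mem_image_of_mem f h₁
  constructor
  · by_contra! h'
    obtain ⟨t, ht, h0⟩ := hc.out m₁ m₀ ⟨h', h.1.le⟩
    have := hs t ht
    simp [h0] at this
  · by_contra! h'
    obtain ⟨t, ht, h0⟩ := hc.out m₀ m₁ ⟨h.2.le, h'⟩
    have := hs t ht
    simp [h0] at this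

/-- A continuous nowhere vanishing complex function on the plane has a continuous logarithm. -/
theorem exists_continuous_log {h : ℝ × ℝ → ℂ} (hc : Continuous h) (h0 : ∀ z, h z ≠ 0) :
    ∃ g : ℝ × ℝ → ℂ, Continuous g ∧ ∀ z, Complex.exp (g z) = h z := by
  let f : C(ℝ × ℝ, {z : ℂ // z ≠ 0}) := ⟨fun z => ⟨h z, h0 z⟩, by fun_prop⟩
  obtain ⟨F, ⟨-, hF⟩, -⟩ := Complex.isCoveringMap_exp.existsUnique_continuousMap_lifts f (0, 0)
    (Complex.log (h (0, 0))) (Subtype.ext (Complex.exp_log (h0 _)))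
  exact ⟨F, F.continuous, fun z => congrArg Subtype.val (congrFun hF z)⟩

/-- The Poincaré–Miranda theorem in the plane. Without a common zero, `F + iG` would have a
continuous logarithm on the rectangle, but the sign conditions force its argument to increase
by `2π` along the boundary. -/
theorem exists_common_zero {F G : ℝ × ℝ → ℝ} (hF : Continuous F) (hG : Continuous G)
    {a b c d : ℝ} (hab : a ≤ b) (hcd : c ≤ d)
    (hFa : ∀ y ∈ Icc c d, F (a, y) < 0) (hFb : ∀ y ∈ Icc c d, 0 < F (b, y))
    (hGc : ∀ x ∈ Icc a b, G (x, c) < 0) (hGd : ∀ x ∈ Icc a b, 0 < G (x, d)) :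
    ∃ x y, F (x, y) = 0 ∧ G (x, y) = 0 := by
  by_contra! hne
  obtain ⟨g, hg, hexp⟩ := exists_continuous_log (h := fun z => (F z : ℂ) + G z * Complex.I)
    (by fun_prop) (fun z h => by
      have h1 := congrArg Complex.re h
      have h2 := congrArg Complex.im h
      simp only [Complex.add_re, Complex.ofReal_re, Complex.mul_re, Complex.I_re, mul_zero,
        Complex.ofReal_im, Complex.I_im, mul_one, sub_self, add_zero, Complex.zero_re,
        Complex.add_im, Complex.mul_im, zero_add, Complex.zero_im] at h1 h2
      exact hne z.1 z.2 h1 h2)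
  have hre : ∀ z, Real.exp (g z).re * Real.cos (g z).im = F z := fun z => by
    rw [← Complex.exp_re, hexp]; simp
  have him : ∀ z, Real.exp (g z).re * Real.sin (g z).im = G z := fun z => by
    rw [← Complex.exp_im, hexp]; simp
  -- the argument, normalized to lie in `(-π, π]` at the corner `(b, c)`
  obtain ⟨m, hm, -⟩ := existsUnique_add_zsmul_mem_Ioc Real.two_pi_pos (g (b, c)).im (-Real.pi)
  set θ : ℝ × ℝ → ℝ := fun z => (g z).im + m • (2 * Real.pi) with hθ
  have hθc : Continuous θ := by fun_prop
  have hcos : ∀ z, Real.exp (g z).re * Real.cos (θ z) = F z := fun z => by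
    rw [hθ, ← hre]; simp only [zsmul_eq_mul, Real.cos_add_int_mul_two_pi]
  have hsin : ∀ z, Real.exp (g z).re * Real.sin (θ z) = G z := fun z => by
    rw [hθ, ← him]; simp only [zsmul_eq_mul, Real.sin_add_int_mul_two_pi]
  have cpos : ∀ z, 0 < F z → 0 < Real.cos (θ z) := fun z h =>
    pos_of_mul_pos_right ((hcos z).symm ▸ h) (Real.exp_pos _).le
  have spos : ∀ z, 0 < G z → 0 < Real.sin (θ z) := fun z h =>
    pos_of_mul_pos_right ((hsin z).symm ▸ h) (Real.exp_pos _).le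
  have cneg : ∀ z, F z < 0 → Real.cos (θ z) < 0 := fun z h =>
    neg_of_mul_neg_right ((hcos z).symm ▸ h) (Real.exp_pos _).le
  have sneg : ∀ z, G z < 0 → Real.sin (θ z) < 0 := fun z h =>
    neg_of_mul_neg_right ((hsin z).symm ▸ h) (Real.exp_pos _).le
  have hpi := Real.pi_pos
  have ha := left_mem_Icc.2 hab
  have hb := right_mem_Icc.2 hab
  have hc := left_mem_Icc.2 hcd
  have hd := right_mem_Icc.2 hcd
  -- the corner `(b, c)`
  have h1 : θ (b, c) < 0 := by
    by_contra! h
    have := Real.sin_nonneg_of_nonneg_of_le_pi h (by have := hm.2; simp only [hθ]; linarith)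
    linarith [sneg (b, c) (hGc b hb)]
  have h2 : -(Real.pi / 2) < θ (b, c) := by
    by_contra! h
    have h3 := Real.cos_nonpos_of_pi_div_two_le_of_le (x := -θ (b, c)) (by linarith)
      (by have := hm.1; simp only [hθ]; linarith)
    rw [Real.cos_neg] at h3
    linarith [cpos (b, c) (hFb c hc)]
  -- the right side
  have h3 := mem_Ioo_of_sin_pos (f := fun t => θ (b, t) + Real.pi / 2) (by fun_prop)
    (fun t ht => by rw [Real.sin_add_pi_div_two]; exact cpos _ (hFb t ht)) hc hd
    ⟨by linarith, by linarith⟩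
  have h4 : 0 < θ (b, d) := by
    by_contra! h
    have := Real.sin_nonpos_of_nonpos_of_neg_pi_le h (by linarith [h3.1])
    linarith [spos (b, d) (hGd b hb)]
  -- the upper side
  have h5 := mem_Ioo_of_sin_pos (f := fun t => θ (t, d)) (by fun_prop)
    (fun t ht => spos _ (hGd t ht)) hb ha ⟨h4, by linarith [h3.2]⟩
  have h6 : Real.pi / 2 < θ (a, d) := by
    by_contra! h
    have := Real.cos_nonneg_of_neg_pi_div_two_le_of_le (by linarith [h5.1]) h
    linarith [cneg (a, d) (hFa d hd)]
  -- the left side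
  have h7 := mem_Ioo_of_sin_pos (f := fun t => θ (a, t) - Real.pi / 2) (by fun_prop)
    (fun t ht => by rw [Real.sin_sub_pi_div_two]; linarith [cneg _ (hFa t ht)]) hd hc
    ⟨by linarith, by linarith [h5.2]⟩
  -- the lower side
  have h8 := mem_Ioo_of_sin_pos (f := fun t => θ (t, c) + Real.pi) (by fun_prop)
    (fun t ht => by rw [Real.sin_add_pi]; linarith [sneg _ (hGc t ht)]) hb ha
    ⟨by linarith, by linarith⟩
  have h9 := sneg (a, c) (hGc a ha)
  linarith [Real.sin_nonneg_of_nonneg_of_le_pi (x := θ (a, c)) (by linarith [h7.1])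
    (by linarith [h8.2])]

theorem exists_common_zero_mem_rectangle {F G : ℝ × ℝ → ℝ} (hF : Continuous F) (hG : Continuous G)
    {a b c d : ℝ} (hab : a ≤ b) (hcd : c ≤ d)
    (hFa : ∀ y ∈ Icc c d, F (a, y) < 0) (hFb : ∀ y ∈ Icc c d, 0 < F (b, y))
    (hGc : ∀ x ∈ Icc a b, G (x, c) < 0) (hGd : ∀ x ∈ Icc a b, 0 < G (x, d)) :
    ∃ x ∈ Icc a b, ∃ y ∈ Icc c d, F (x, y) = 0 ∧ G (x, y) = 0 := by
  -- retract the plane onto the rectangle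
  set r : ℝ × ℝ → ℝ × ℝ := fun z => (projIcc a b hab z.1, projIcc c d hcd z.2) with hr
  have hrc : Continuous r := by
    have h1 := continuous_projIcc (h := hab)
    have h2 := continuous_projIcc (h := hcd)
    fun_prop
  have hx : ∀ x ∈ Icc a b, (projIcc a b hab x : ℝ) = x := fun x h => by
    rw [projIcc_of_mem _ h]
  have hy : ∀ y ∈ Icc c d, (projIcc c d hcd y : ℝ) = y := fun y h => by
    rw [projIcc_of_mem _ h]
  obtain ⟨x, y, h1, h2⟩ := exists_common_zero (hF.comp hrc) (hG.comp hrc) hab hcd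
    (fun y h => by simpa [hr, hy y h] using hFa y h) (fun y h => by simpa [hr, hy y h] using hFb y h)
    (fun x h => by simpa [hr, hx x h] using hGc x h) (fun x h => by simpa [hr, hx x h] using hGd x h)
  exact ⟨_, (projIcc a b hab x).2, _, (projIcc c d hcd y).2, h1, h2⟩

/-- Two continuous maps to the unit sphere meet stably: all nearby continuous maps to the sphere
still take a common value. Closeness is uniform on `ℝ`. -/
def MeetStably {E : Type*} [NormedAddCommGroup E] (p q : ℝ → E) : Prop :=
  ∃ δ > 0, ∀ P Q : ℝ → E, Continuous P → Continuous Q → (∀ x, ‖P x‖ = 1) → (∀ x, ‖Q x‖ = 1) →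
    (∀ x, ‖P x - p x‖ < δ) → (∀ x, ‖Q x - q x‖ < δ) → ∃ x y, P x = Q y

theorem MeetStably.symm {E : Type*} [NormedAddCommGroup E] {p q : ℝ → E} (h : MeetStably p q) :
    MeetStably q p := by
  obtain ⟨δ, hδ, h⟩ := h
  refine ⟨δ, hδ, fun P Q hP hQ hP1 hQ1 hPp hQq => ?_⟩
  obtain ⟨x, y, hxy⟩ := h Q P hQ hP hQ1 hP1 hQq hPp
  exact ⟨y, x, hxy.symm⟩

theorem MeetStably.comp {E : Type*} [NormedAddCommGroup E] {p q : ℝ → E} (h : MeetStably p q)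
    (l : ℝ ≃ ℝ) (hl : Continuous l.symm) : MeetStably (p ∘ l) (q ∘ l) := by
  obtain ⟨δ, hδ, h⟩ := h
  refine ⟨δ, hδ, fun P Q hP hQ hP1 hQ1 hPp hQq => ?_⟩
  obtain ⟨x, y, hxy⟩ := h (P ∘ l.symm) (Q ∘ l.symm) (hP.comp hl) (hQ.comp hl)
    (fun _ => hP1 _) (fun _ => hQ1 _) (fun x => by simpa using hPp (l.symm x))
    (fun x => by simpa using hQq (l.symm x))
  exact ⟨_, _, hxy⟩

theorem MeetStably.exists_eq {E : Type*} [NormedAddCommGroup E] {p q : ℝ → E} (h : MeetStably p q)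
    (hp : Continuous p) (hq : Continuous q) (hp1 : ∀ x, ‖p x‖ = 1) (hq1 : ∀ x, ‖q x‖ = 1) :
    ∃ x y, p x = q y := by
  obtain ⟨δ, hδ, h⟩ := h
  exact h p q hp hq hp1 hq1 (fun x => by simpa using hδ) (fun x => by simpa using hδ)

/-- Two unit vectors on the same side of the plane spanned by `f₁, f₂` coincide as soon as their
`f₁`- and `f₂`-components do. -/
theorem eq_of_inner_eq {e f₁ f₂ u v : Space 3} (ho : Orthonormal ℝ ![e, f₁, f₂])
    (hu : ‖u‖ = 1) (hv : ‖v‖ = 1) (hue : 0 < inner ℝ e u) (hve : 0 < inner ℝ e v)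
    (h₁ : inner ℝ f₁ u = inner ℝ f₁ v) (h₂ : inner ℝ f₂ u = inner ℝ f₂ v) : u = v := by
  have hcard : Module.finrank ℝ (Space 3) = Fintype.card (Fin 3) := by simp
  let b := basisOfOrthonormalOfCardEqFinrank ho hcard.symm
  have hb : Orthonormal ℝ b := by
    rw [coe_basisOfOrthonormalOfCardEqFinrank]; exact ho
  let ob := b.toOrthonormalBasis hb
  have hob : ∀ i, ob i = ![e, f₁, f₂] i := fun i => by simp [ob, b]
  have hn : ∀ w : Space 3, ‖w‖ ^ 2 = inner ℝ e w ^ 2 + inner ℝ f₁ w ^ 2 + inner ℝ f₂ w ^ 2 := by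
    intro w
    rw [← ob.sum_sq_norm_inner_right w]
    simp [Fin.sum_univ_three, hob]
  have hu' := hn u
  have hv' := hn v
  rw [hu, h₁, h₂] at hu'
  rw [hv] at hv'
  have he : inner ℝ e u = inner ℝ e v := by nlinarith
  refine ob.repr.injective ?_
  ext i
  rw [ob.repr_apply_apply, ob.repr_apply_apply, hob]
  fin_cases i <;> simp [he, h₁, h₂]

/-- A curve whose `f₁`-component changes sign while its `f₂`-component vanishes crosses, stably,
a curve with the roles of `f₁` and `f₂` exchanged. -/
theorem meetStably_of_crossing {e f₁ f₂ : Space 3} (ho : Orthonormal ℝ ![e, f₁, f₂])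
    {p q : ℝ → Space 3} {a b c d η : ℝ} (hab : a ≤ b) (hcd : c ≤ d) (hη : 0 < η)
    (hpe : ∀ x ∈ Icc a b, η ≤ inner ℝ e (p x)) (hqe : ∀ y ∈ Icc c d, η ≤ inner ℝ e (q y))
    (hp₂ : ∀ x ∈ Icc a b, inner ℝ f₂ (p x) = 0) (hq₁ : ∀ y ∈ Icc c d, inner ℝ f₁ (q y) = 0)
    (hpa : inner ℝ f₁ (p a) ≤ -η) (hpb : η ≤ inner ℝ f₁ (p b))
    (hqc : inner ℝ f₂ (q c) ≤ -η) (hqd : η ≤ inner ℝ f₂ (q d)) : MeetStably p q := by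
  refine ⟨η / 2, by positivity, fun P Q hP hQ hP1 hQ1 hPp hQq => ?_⟩
  have hc : ∀ (f u v : Space 3), ‖f‖ = 1 → ‖u - v‖ < η / 2 →
      |inner ℝ f u - inner ℝ f v| < η / 2 := fun f u v hf h => by
    rw [← inner_sub_right]
    refine (abs_real_inner_le_norm _ _).trans_lt ?_
    rwa [hf, one_mul]
  have n0 : ‖e‖ = 1 := by simpa using ho.1 0
  have n1 : ‖f₁‖ = 1 := by simpa using ho.1 1
  have n2 : ‖f₂‖ = 1 := by simpa using ho.1 2
  have hP' := fun f hf x => abs_lt.1 (hc f (P x) (p x) hf (hPp x))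
  have hQ' := fun f hf x => abs_lt.1 (hc f (Q x) (q x) hf (hQq x))
  obtain ⟨x, hx, y, hy, hF, hG⟩ := exists_common_zero_mem_rectangle
    (F := fun z => inner ℝ f₁ (P z.1) - inner ℝ f₁ (Q z.2))
    (G := fun z => inner ℝ f₂ (Q z.2) - inner ℝ f₂ (P z.1)) (by fun_prop) (by fun_prop) hab hcd
    (fun y hy => by
      have := hq₁ y hy; have := hP' f₁ n1 a; have := hQ' f₁ n1 y
      dsimp only; linarith)
    (fun y hy => by
      have := hq₁ y hy; have := hP' f₁ n1 b; have := hQ' f₁ n1 y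
      dsimp only; linarith)
    (fun x hx => by
      have := hp₂ x hx; have := hP' f₂ n2 x; have := hQ' f₂ n2 c
      dsimp only; linarith)
    (fun x hx => by
      have := hp₂ x hx; have := hP' f₂ n2 x; have := hQ' f₂ n2 d
      dsimp only; linarith)
  refine ⟨x, y, eq_of_inner_eq ho (hP1 x) (hQ1 y) ?_ ?_ (sub_eq_zero.1 hF) (sub_eq_zero.1 hG).symm⟩
  · have := hpe x hx; have := hP' e n0 x; linarith
  · have := hqe y hy; have := hQ' e n0 y; linarith

/-! ### Divergence-free fields in the plane -/

/-- The linear map on the plane with partial derivatives `a` and `b`. -/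
def ofPartials {E : Type*} [NormedAddCommGroup E] [NormedSpace ℝ E] (a b : E) : ℝ × ℝ →L[ℝ] E :=
  (ContinuousLinearMap.toSpanSingleton ℝ a).coprod (ContinuousLinearMap.toSpanSingleton ℝ b)

@[simp]
theorem ofPartials_apply {E : Type*} [NormedAddCommGroup E] [NormedSpace ℝ E] (a b : E)
    (z : ℝ × ℝ) : ofPartials a b z = z.1 • a + z.2 • b := by
  simp [ofPartials]

theorem ofPartials_eta {E : Type*} [NormedAddCommGroup E] [NormedSpace ℝ E]
    (D : ℝ × ℝ →L[ℝ] E) : ofPartials (D (1, 0)) (D (0, 1)) = D := by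
  ext <;> simp

theorem continuous_ofPartials {E X : Type*} [NormedAddCommGroup E] [NormedSpace ℝ E]
    [TopologicalSpace X] {a b : X → E} (ha : Continuous a) (hb : Continuous b) :
    Continuous fun x => ofPartials (a x) (b x) := by
  have h : ∀ x, ofPartials (a x) (b x) =
      (ContinuousLinearMap.fst ℝ ℝ ℝ).smulRight (a x) +
        (ContinuousLinearMap.snd ℝ ℝ ℝ).smulRight (b x) := fun x => by ext <;> simp
  simp_rw [h]
  have h1 : Continuous fun x => (ContinuousLinearMap.fst ℝ ℝ ℝ).smulRight (a x) :=
    (ContinuousLinearMap.smulRightL ℝ (ℝ × ℝ) E (ContinuousLinearMap.fst ℝ ℝ ℝ)).continuous.comp ha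
  have h2 : Continuous fun x => (ContinuousLinearMap.snd ℝ ℝ ℝ).smulRight (b x) :=
    (ContinuousLinearMap.smulRightL ℝ (ℝ × ℝ) E (ContinuousLinearMap.snd ℝ ℝ ℝ)).continuous.comp hb
  exact h1.add h2

/-- A function on the plane with continuous partial derivatives is strictly differentiable. -/
theorem hasStrictFDerivAt_of_partials {E : Type*} [NormedAddCommGroup E] [NormedSpace ℝ E]
    {f : ℝ × ℝ → E} {a b : ℝ × ℝ → E} (ha : Continuous a) (hb : Continuous b)
    (hfa : ∀ t x, HasDerivAt (fun s => f (s, x)) (a (t, x)) t)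
    (hfb : ∀ t x, HasDerivAt (fun y => f (t, y)) (b (t, x)) x) (z : ℝ × ℝ) :
    HasStrictFDerivAt f (ofPartials (a z) (b z)) z := by
  have hc : ∀ {g : ℝ × ℝ → E}, Continuous g →
      Continuous fun z => ContinuousLinearMap.toSpanSingleton ℝ (g z) := fun hg =>
    (ContinuousLinearMap.toSpanSingletonCLE (𝕜 := ℝ) (E := E)).continuous.comp hg
  exact hasStrictFDerivAt_uncurry_coprod (f := fun t x => f (t, x))
    (f₁ := fun t x => ContinuousLinearMap.toSpanSingleton ℝ (a (t, x)))
    (f₂ := fun t x => ContinuousLinearMap.toSpanSingleton ℝ (b (t, x)))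
    (Filter.Eventually.of_forall fun v => (hfa v.1 v.2).hasFDerivAt)
    (Filter.Eventually.of_forall fun v => (hfb v.1 v.2).hasFDerivAt)
    (hc ha).continuousAt (hc hb).continuousAt

/-- Convolution with a compactly supported `C¹` function is differentiable, and the derivative
falls on the latter. -/
theorem hasFDerivAt_mollify {P g : ℝ × ℝ → ℝ} (hP : Continuous P) (hg : ContDiff ℝ 1 g)
    (hs : HasCompactSupport g) (z : ℝ × ℝ) :
    HasFDerivAt (fun z => ∫ w, P w * g (z - w))
      (ofPartials (∫ w, P w * fderiv ℝ g (z - w) (1, 0)) (∫ w, P w * fderiv ℝ g (z - w) (0, 1)))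
      z := by
  have h := hs.hasFDerivAt_convolution_right (ContinuousLinearMap.mul ℝ ℝ)
    (hP.locallyIntegrable (μ := volume)) hg z
  have h' : ∀ v, (convolution P (fderiv ℝ g)
      (ContinuousLinearMap.precompR (ℝ × ℝ) (ContinuousLinearMap.mul ℝ ℝ)) volume z) v
      = ∫ w, P w * fderiv ℝ g (z - w) v := fun v => by
    rw [convolution_precompR_apply _ hP.locallyIntegrable (hs.fderiv ℝ)
      (hg.continuous_fderiv one_ne_zero)]
    simp [convolution]
  rw [← ofPartials_eta (convolution _ _ _ _ z), h', h'] at h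
  exact h

theorem continuous_integral_mul_shift {P g : ℝ × ℝ → ℝ} (hP : Continuous P) (hg : Continuous g)
    (hs : HasCompactSupport g) : Continuous fun z => ∫ w, P w * g (z - w) := by
  have := hs.continuous_convolution_right (ContinuousLinearMap.mul ℝ ℝ)
    (hP.locallyIntegrable (μ := volume)) hg
  exact this

theorem integrable_mul_shift {P g : ℝ × ℝ → ℝ} (hP : Continuous P) (hg : Continuous g)
    (hs : HasCompactSupport g) (z : ℝ × ℝ) : Integrable fun w => P w * g (z - w) := by
  refine Continuous.integrable_of_hasCompactSupport (by fun_prop) ?_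
  exact (hs.comp_homeomorph (Homeomorph.subLeft z)).mul_left

/-- The field `(P, Q)` is divergence-free in the weak sense: its distributional divergence vanishes.
-/
def IsWeaklyDivFree (P Q : ℝ × ℝ → ℝ) : Prop :=
  ∀ φ : ℝ × ℝ → ℝ, ContDiff ℝ 1 φ → HasCompactSupport φ →
    ∫ z, (P z * fderiv ℝ φ z (1, 0) + Q z * fderiv ℝ φ z (0, 1)) = 0

theorem hasCompactSupport_fderiv_apply {φ : ℝ × ℝ → ℝ} (hs : HasCompactSupport φ) (v : ℝ × ℝ) :
    HasCompactSupport fun z => fderiv ℝ φ z v :=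
  (hs.fderiv ℝ).comp_left (g := fun D : ℝ × ℝ →L[ℝ] ℝ => D v) rfl

theorem continuous_fderiv_apply_const {φ : ℝ × ℝ → ℝ} (h : ContDiff ℝ 1 φ) (v : ℝ × ℝ) :
    Continuous fun z => fderiv ℝ φ z v :=
  (h.continuous_fderiv one_ne_zero).clm_apply continuous_const

theorem fderiv_reflect (φ : ℝ × ℝ → ℝ) (h : ContDiff ℝ 1 φ) (z w v : ℝ × ℝ) :
    fderiv ℝ (fun y => φ (z - y)) w v = - fderiv ℝ φ (z - w) v := by
  have h1 : HasFDerivAt (fun y => φ (z - y)) ((fderiv ℝ φ (z - w)).comp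
      (-ContinuousLinearMap.id ℝ (ℝ × ℝ))) w := by
    have h2 := ((h.differentiable one_ne_zero) (z - w)).hasFDerivAt
    refine HasFDerivAt.comp w h2 ?_
    simpa using (hasFDerivAt_id w).const_sub z
  rw [h1.fderiv]; simp

/-- Integration by parts against a reflected test function. -/
theorem integral_mul_fderiv_shift {W a g : ℝ × ℝ → ℝ} {D : ℝ × ℝ → ℝ × ℝ →L[ℝ] ℝ} {v : ℝ × ℝ}
    (hW : ∀ z, HasFDerivAt W (D z) z) (ha : Continuous a) (hv : ∀ z, D z v = a z)
    (hg : ContDiff ℝ 1 g) (hs : HasCompactSupport g) (z : ℝ × ℝ) :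
    ∫ w, W w * fderiv ℝ g (z - w) v = ∫ w, a w * g (z - w) := by
  have hWc : Continuous W := continuous_iff_continuousAt.2 fun z => (hW z).continuousAt
  have hd : ∀ w, HasFDerivAt (fun y => g (z - y)) (fderiv ℝ (fun y => g (z - y)) w) w := fun w =>
    ((hg.comp (contDiff_const.sub contDiff_id)).differentiable one_ne_zero w).hasFDerivAt
  have h := integral_bilinear_hasFDerivAt_right_eq_neg_left_of_integrable (μ := volume)
    (B := ContinuousLinearMap.mul ℝ ℝ) (f := W) (f' := D) (g := fun y => g (z - y))
    (g' := fun w => fderiv ℝ (fun y => g (z - y)) w) (v := v)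
    (by simpa [hv] using integrable_mul_shift ha hg.continuous hs z)
    (by
      simp only [fderiv_reflect g hg, ContinuousLinearMap.mul_apply', mul_neg]
      exact (integrable_mul_shift hWc (continuous_fderiv_apply_const hg v)
        (hasCompactSupport_fderiv_apply hs v) z).neg)
    (by simpa using integrable_mul_shift hWc hg.continuous hs z)
    (fun w _ => hW w) (fun w _ => hd w)
  simp only [fderiv_reflect g hg, ContinuousLinearMap.mul_apply', hv, mul_neg, integral_neg,
    neg_inj] at h
  exact h

/-- The rotated gradient of a `C¹` function is weakly divergence-free. The mixed second derivatives
of a mollification of the potential agree, and the mollifier may be taken to be the reflected test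
function. -/
theorem isWeaklyDivFree_of_potential {W P Q : ℝ × ℝ → ℝ} (hP : Continuous P) (hQ : Continuous Q)
    (hW : ∀ z, HasFDerivAt W (ofPartials (-Q z) (P z)) z) : IsWeaklyDivFree P Q := by
  intro φ hφ hs
  have hWc : Continuous W := continuous_iff_continuousAt.2 fun z => (hW z).continuousAt
  set g : ℝ × ℝ → ℝ := fun y => φ (-y) with hg
  have hgd : ContDiff ℝ 1 g := hφ.comp contDiff_neg
  have hgs : HasCompactSupport g := hs.comp_homeomorph (Homeomorph.neg (ℝ × ℝ))
  have h1 : ∀ z, HasFDerivAt (fun z => ∫ w, W w * g (z - w))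
      (ofPartials (∫ w, -Q w * g (z - w)) (∫ w, P w * g (z - w))) z := fun z => by
    have := hasFDerivAt_mollify hWc hgd hgs z
    rwa [integral_mul_fderiv_shift (v := (1, 0)) hW hQ.neg (by simp) hgd hgs,
      integral_mul_fderiv_shift (v := (0, 1)) hW hP (by simp) hgd hgs] at this
  have h2 := hasFDerivAt_mollify hQ.neg hgd hgs 0
  have h3 := hasFDerivAt_mollify hP hgd hgs 0
  have h4 : HasFDerivAt (fun z => ofPartials (∫ w, -Q w * g (z - w)) (∫ w, P w * g (z - w)))
      (((ContinuousLinearMap.smulRightL ℝ (ℝ × ℝ) ℝ (ContinuousLinearMap.fst ℝ ℝ ℝ)).comp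
        (ofPartials (∫ w, -Q w * fderiv ℝ g (0 - w) (1, 0))
          (∫ w, -Q w * fderiv ℝ g (0 - w) (0, 1)))) +
      ((ContinuousLinearMap.smulRightL ℝ (ℝ × ℝ) ℝ (ContinuousLinearMap.snd ℝ ℝ ℝ)).comp
        (ofPartials (∫ w, P w * fderiv ℝ g (0 - w) (1, 0))
          (∫ w, P w * fderiv ℝ g (0 - w) (0, 1))))) 0 := by
    have := ((ContinuousLinearMap.smulRightL ℝ (ℝ × ℝ) ℝ
      (ContinuousLinearMap.fst ℝ ℝ ℝ)).hasFDerivAt.comp 0 h2).add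
      ((ContinuousLinearMap.smulRightL ℝ (ℝ × ℝ) ℝ
      (ContinuousLinearMap.snd ℝ ℝ ℝ)).hasFDerivAt.comp 0 h3)
    refine this.congr_of_eventuallyEq (Filter.Eventually.of_forall fun z => ?_)
    ext <;> simp
  have h5 := second_derivative_symmetric h1 h4 (1, 0) (0, 1)
  have hgr : ∀ w v, fderiv ℝ g (-w) v = - fderiv ℝ φ w v := fun w v => by
    have := fderiv_reflect φ hφ 0 (-w) v
    simpa [hg] using this
  simp [hgr, integral_neg] at h5
  rw [integral_add, ← h5, add_neg_cancel]
  · exact (hP.mul (continuous_fderiv_apply_const hφ _)).integrable_of_hasCompactSupport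
      (hasCompactSupport_fderiv_apply hs _).mul_left
  · exact (hQ.mul (continuous_fderiv_apply_const hφ _)).integrable_of_hasCompactSupport
      (hasCompactSupport_fderiv_apply hs _).mul_left

theorem exists_mollifier {P : ℝ × ℝ → ℝ} (hP : Continuous P) {K : Set (ℝ × ℝ)} (hK : IsCompact K)
    {ε : ℝ} (hε : 0 < ε) : ∃ r > 0, ∀ φ : ContDiffBump (0 : ℝ × ℝ), φ.rOut ≤ r →
      ∀ z ∈ K, |(∫ w, P w * φ.normed volume (z - w)) - P z| ≤ ε := by
  have h := hK.uniformContinuousAt_of_continuousAt P (fun a _ => hP.continuousAt)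
    (Metric.dist_mem_uniformity hε)
  obtain ⟨r, hr, h⟩ := Metric.mem_uniformity_dist.1 h
  refine ⟨r, hr, fun φ hφ z hz => ?_⟩
  have := φ.dist_normed_convolution_le (μ := volume) (g := P) (x₀ := z) (ε := ε)
    hP.aestronglyMeasurable (fun x hx => by
      have h1 : dist z x < r := by rw [dist_comm]; exact (Metric.mem_ball.1 hx).trans_le hφ
      have h2 : dist (P z) (P x) < ε := h h1 hz
      rw [dist_comm]; exact h2.le)
  rw [convolution_lsmul_swap, Real.dist_eq] at this
  simpa [mul_comm] using this

/-- The flux of a continuous, weakly divergence-free field through the boundary of a rectangle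
vanishes. -/
theorem IsWeaklyDivFree.flux_eq_zero {P Q : ℝ × ℝ → ℝ} (hP : Continuous P) (hQ : Continuous Q)
    (h : IsWeaklyDivFree P Q) (a₁ b₁ a₂ b₂ : ℝ) :
    (((∫ t in a₁..b₁, Q (t, b₂)) - ∫ t in a₁..b₁, Q (t, a₂)) + ∫ x in a₂..b₂, P (b₁, x)) -
      ∫ x in a₂..b₂, P (a₁, x) = 0 := by
  set K : Set (ℝ × ℝ) := uIcc a₁ b₁ ×ˢ uIcc a₂ b₂ with hK
  have hKc : IsCompact K := isCompact_uIcc.prod isCompact_uIcc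
  have hbound : ∀ ε > 0, |(((∫ t in a₁..b₁, Q (t, b₂)) - ∫ t in a₁..b₁, Q (t, a₂)) +
      ∫ x in a₂..b₂, P (b₁, x)) - ∫ x in a₂..b₂, P (a₁, x)| ≤
      ε * (2 * |b₁ - a₁| + 2 * |b₂ - a₂|) := by
    intro ε hε
    obtain ⟨r₁, hr₁, h₁⟩ := exists_mollifier hP hKc hε
    obtain ⟨r₂, hr₂, h₂⟩ := exists_mollifier hQ hKc hε
    have hr : 0 < min r₁ r₂ := lt_min hr₁ hr₂
    let φ : ContDiffBump (0 : ℝ × ℝ) := ⟨min r₁ r₂ / 2, min r₁ r₂, by linarith, by linarith⟩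
    set g := φ.normed (volume : Measure (ℝ × ℝ)) with hg
    have hgd : ContDiff ℝ 1 g := φ.contDiff_normed
    have hgs : HasCompactSupport g := φ.hasCompactSupport_normed
    have d₁ := h₁ φ (min_le_left _ _)
    have d₂ := h₂ φ (min_le_right _ _)
    set P' := fun z => ∫ w, P w * g (z - w) with hP'
    set Q' := fun z => ∫ w, Q w * g (z - w) with hQ'
    have cP : Continuous P' := continuous_integral_mul_shift hP hgd.continuous hgs
    have cQ : Continuous Q' := continuous_integral_mul_shift hQ hgd.continuous hgs
    -- the mollified field is divergence-free in the classical sense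
    have hdiv : ∀ z, (∫ w, P w * fderiv ℝ g (z - w) (1, 0)) +
        (∫ w, Q w * fderiv ℝ g (z - w) (0, 1)) = 0 := by
      intro z
      rw [← integral_add (integrable_mul_shift hP (continuous_fderiv_apply_const hgd _)
        (hasCompactSupport_fderiv_apply hgs _) z) (integrable_mul_shift hQ
        (continuous_fderiv_apply_const hgd _) (hasCompactSupport_fderiv_apply hgs _) z)]
      have := h (fun w => g (z - w)) (hgd.comp (contDiff_const.sub contDiff_id))
        (hgs.comp_homeomorph (Homeomorph.subLeft z))
      simp only [fderiv_reflect g hgd, mul_neg, ← neg_add, integral_neg, neg_eq_zero] at this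
      exact this
    have hflux := integral2_divergence_prod_of_hasFDerivAt P' Q' _ _ a₁ a₂ b₁ b₂
      cP.continuousOn cQ.continuousOn (fun z _ => hasFDerivAt_mollify hP hgd hgs z)
      (fun z _ => hasFDerivAt_mollify hQ hgd hgs z) (by simp [hdiv])
    simp only [ofPartials_apply, one_smul, zero_smul, add_zero, zero_add, hdiv,
      intervalIntegral.integral_zero] at hflux
    have e₁ : ∀ c ∈ uIcc a₂ b₂, |(∫ t in a₁..b₁, Q (t, c)) - ∫ t in a₁..b₁, Q' (t, c)| ≤
        ε * |b₁ - a₁| := fun c hc => by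
      rw [← intervalIntegral.integral_sub
        ((by fun_prop : Continuous fun t => Q (t, c)).intervalIntegrable _ _)
        ((by fun_prop : Continuous fun t => Q' (t, c)).intervalIntegrable _ _)]
      rw [← Real.norm_eq_abs (∫ _ in _.._, _)]
      refine intervalIntegral.norm_integral_le_of_norm_le_const fun t ht => ?_
      rw [Real.norm_eq_abs, abs_sub_comm]
      exact d₂ (t, c) ⟨uIoc_subset_uIcc ht, hc⟩
    have e₂ : ∀ c ∈ uIcc a₁ b₁, |(∫ x in a₂..b₂, P (c, x)) - ∫ x in a₂..b₂, P' (c, x)| ≤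
        ε * |b₂ - a₂| := fun c hc => by
      rw [← intervalIntegral.integral_sub
        ((by fun_prop : Continuous fun x => P (c, x)).intervalIntegrable _ _)
        ((by fun_prop : Continuous fun x => P' (c, x)).intervalIntegrable _ _)]
      rw [← Real.norm_eq_abs (∫ _ in _.._, _)]
      refine intervalIntegral.norm_integral_le_of_norm_le_const fun x hx => ?_
      rw [Real.norm_eq_abs, abs_sub_comm]
      exact d₁ (c, x) ⟨hc, uIoc_subset_uIcc hx⟩
    have i₁ := abs_le.1 (e₁ b₂ right_mem_uIcc)
    have i₂ := abs_le.1 (e₁ a₂ left_mem_uIcc)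
    have i₃ := abs_le.1 (e₂ b₁ right_mem_uIcc)
    have i₄ := abs_le.1 (e₂ a₁ left_mem_uIcc)
    rw [abs_le]
    constructor <;> linarith
  by_contra hne
  set N := 2 * |b₁ - a₁| + 2 * |b₂ - a₂|
  have hN : 0 ≤ N := by positivity
  have hpos := abs_pos.2 hne
  have := hbound (_ / (2 * (N + 1))) (div_pos hpos (by positivity))
  rw [div_mul_eq_mul_div, le_div_iff₀ (by positivity)] at this
  nlinarith

/-- A continuous, weakly divergence-free field in the plane is a rotated gradient. -/
theorem IsWeaklyDivFree.exists_potential {P Q : ℝ × ℝ → ℝ} (hP : Continuous P) (hQ : Continuous Q)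
    (h : IsWeaklyDivFree P Q) :
    ∃ W : ℝ × ℝ → ℝ, ∀ z, HasStrictFDerivAt W (ofPartials (-Q z) (P z)) z := by
  refine ⟨fun z => (∫ x in (0 : ℝ)..z.2, P (0, x)) - ∫ t in (0 : ℝ)..z.1, Q (t, z.2),
    hasStrictFDerivAt_of_partials hQ.neg hP (fun t x => ?_) (fun t x => ?_)⟩
  · have hc : Continuous fun s => Q (s, x) := by fun_prop
    exact (hc.integral_hasStrictDerivAt 0 t).hasDerivAt.const_sub (∫ y in (0 : ℝ)..x, P (0, y))
  · have hc : Continuous fun y => P (t, y) := by fun_prop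
    have h1 := (hc.integral_hasStrictDerivAt 0 x).hasDerivAt.sub_const
      (∫ s in (0 : ℝ)..t, Q (s, 0))
    refine h1.congr_of_eventuallyEq (Filter.Eventually.of_forall fun y => ?_)
    have := h.flux_eq_zero hP hQ 0 t 0 y
    dsimp only
    linarith

variable {n : ℕ}

/-! ### The first variation of the Minkowskian area -/

theorem minkowskiInner_add_left (X Y Z : Minkowski n) :
    minkowskiInner (X + Y) Z = minkowskiInner X Z + minkowskiInner Y Z := by
  simp [minkowskiInner, inner_add_left]; ring

theorem minkowskiInner_smul_left (r : ℝ) (X Y : Minkowski n) :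
    minkowskiInner (r • X) Y = r * minkowskiInner X Y := by
  simp [minkowskiInner, inner_smul_left]; ring

theorem minkowskiInner_comm (X Y : Minkowski n) : minkowskiInner X Y = minkowskiInner Y X := by
  simp [minkowskiInner, real_inner_comm, mul_comm]

theorem minkowskiInner_add_right (X Y Z : Minkowski n) :
    minkowskiInner X (Y + Z) = minkowskiInner X Y + minkowskiInner X Z := by
  simp [minkowskiInner, inner_add_right]; ring

theorem minkowskiInner_smul_right (r : ℝ) (X Y : Minkowski n) :
    minkowskiInner X (r • Y) = r * minkowskiInner X Y := by
  simp [minkowskiInner, inner_smul_right]; ring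

theorem minkowskiInner_sub_left (X Y Z : Minkowski n) :
    minkowskiInner (X - Y) Z = minkowskiInner X Z - minkowskiInner Y Z := by
  simp [minkowskiInner, inner_sub_left]; ring

theorem minkowskiInner_eq_sum (X Y : Minkowski n) :
    minkowskiInner X Y = -(X.1 * Y.1) + ∑ i, X.2 i * Y.2 i := by
  simp [minkowskiInner, PiLp.inner_apply, mul_comm]

theorem continuous_minkowskiInner {A : Type*} [TopologicalSpace A] {f g : A → Minkowski n}
    (hf : Continuous f) (hg : Continuous g) :
    Continuous fun a => minkowskiInner (f a) (g a) := by
  unfold minkowskiInner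
  have h1 := hf.fst
  have h2 := hf.snd
  have h3 := hg.fst
  have h4 := hg.snd
  fun_prop

theorem continuous_partialT {ψ : ℝ × ℝ → Minkowski n} (h : ContDiff ℝ 1 ψ) :
    Continuous (partialT ψ) :=
  (h.continuous_fderiv one_ne_zero).clm_apply continuous_const

theorem continuous_partialX {ψ : ℝ × ℝ → Minkowski n} (h : ContDiff ℝ 1 ψ) :
    Continuous (partialX ψ) :=
  (h.continuous_fderiv one_ne_zero).clm_apply continuous_const

theorem continuous_metricDet {ψ : ℝ × ℝ → Minkowski n} (h : ContDiff ℝ 1 ψ) :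
    Continuous (metricDet ψ) := by
  have h1 := continuous_partialT h
  have h2 := continuous_partialX h
  exact ((continuous_minkowskiInner h1 h1).mul (continuous_minkowskiInner h2 h2)).sub
    ((continuous_minkowskiInner h1 h2).mul (continuous_minkowskiInner h2 h1))

/-- The component `√|g| g^{ti} ∂ᵢψ` of the conserved current of an extremal surface,
up to sign. -/
def fluxT (ψ : ℝ × ℝ → Minkowski n) (z : ℝ × ℝ) : Minkowski n :=
  (Real.sqrt (-metricDet ψ z))⁻¹ • (minkowskiInner (partialX ψ z) (partialX ψ z) • partialT ψ z -
    minkowskiInner (partialT ψ z) (partialX ψ z) • partialX ψ z)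

/-- The component `√|g| g^{xi} ∂ᵢψ` of the conserved current of an extremal surface,
up to sign. -/
def fluxX (ψ : ℝ × ℝ → Minkowski n) (z : ℝ × ℝ) : Minkowski n :=
  (Real.sqrt (-metricDet ψ z))⁻¹ • (minkowskiInner (partialT ψ z) (partialT ψ z) • partialX ψ z -
    minkowskiInner (partialT ψ z) (partialX ψ z) • partialT ψ z)

theorem continuous_inv_sqrt_metricDet {ψ : ℝ × ℝ → Minkowski n} (h : ContDiff ℝ 1 ψ)
    (ht : IsTimelike ψ) : Continuous fun z => (Real.sqrt (-metricDet ψ z))⁻¹ :=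
  (continuous_metricDet h).neg.sqrt.inv₀ fun z => (Real.sqrt_pos.2 (neg_pos.2 (ht z))).ne'

theorem continuous_fluxT {ψ : ℝ × ℝ → Minkowski n} (h : ContDiff ℝ 1 ψ) (ht : IsTimelike ψ) :
    Continuous (fluxT ψ) := by
  have h1 := continuous_partialT h
  have h2 := continuous_partialX h
  exact (continuous_inv_sqrt_metricDet h ht).smul (((continuous_minkowskiInner h2 h2).smul h1).sub
    ((continuous_minkowskiInner h1 h2).smul h2))

theorem continuous_fluxX {ψ : ℝ × ℝ → Minkowski n} (h : ContDiff ℝ 1 ψ) (ht : IsTimelike ψ) :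
    Continuous (fluxX ψ) := by
  have h1 := continuous_partialT h
  have h2 := continuous_partialX h
  exact (continuous_inv_sqrt_metricDet h ht).smul (((continuous_minkowskiInner h1 h1).smul h2).sub
    ((continuous_minkowskiInner h1 h2).smul h1))

/-- The derivative in `s` of the metric determinant of `ψ + s φ`. -/
def metricDetVar (ψ φ : ℝ × ℝ → Minkowski n) (s : ℝ) (z : ℝ × ℝ) : ℝ :=
  2 * (minkowskiInner (partialT ψ z + s • partialT φ z) (partialT φ z) *
      minkowskiInner (partialX ψ z + s • partialX φ z) (partialX ψ z + s • partialX φ z) +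
    minkowskiInner (partialT ψ z + s • partialT φ z) (partialT ψ z + s • partialT φ z) *
      minkowskiInner (partialX ψ z + s • partialX φ z) (partialX φ z) -
    minkowskiInner (partialT ψ z + s • partialT φ z) (partialX ψ z + s • partialX φ z) *
      (minkowskiInner (partialX ψ z + s • partialX φ z) (partialT φ z) +
        minkowskiInner (partialT ψ z + s • partialT φ z) (partialX φ z)))

section Variation

variable {ψ φ : ℝ × ℝ → Minkowski n}

theorem metricDet_add_smul (hψ : ContDiff ℝ 1 ψ) (hφ : ContDiff ℝ 1 φ) (s : ℝ) (z : ℝ × ℝ) :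
    metricDet (fun z => ψ z + s • φ z) z =
      minkowskiInner (partialT ψ z + s • partialT φ z) (partialT ψ z + s • partialT φ z) *
        minkowskiInner (partialX ψ z + s • partialX φ z) (partialX ψ z + s • partialX φ z) -
      minkowskiInner (partialT ψ z + s • partialT φ z) (partialX ψ z + s • partialX φ z) *
        minkowskiInner (partialX ψ z + s • partialX φ z) (partialT ψ z + s • partialT φ z) := by
  have h1 : fderiv ℝ (fun z => ψ z + s • φ z) z = fderiv ℝ ψ z + s • fderiv ℝ φ z :=
    (((hψ.differentiable one_ne_zero z).hasFDerivAt).add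
      (((hφ.differentiable one_ne_zero z).hasFDerivAt).const_smul s)).fderiv
  simp only [metricDet, partialT, partialX, h1, add_apply, smul_apply]

theorem hasDerivAt_metricDet (hψ : ContDiff ℝ 1 ψ) (hφ : ContDiff ℝ 1 φ) (s : ℝ) (z : ℝ × ℝ) :
    HasDerivAt (fun s => metricDet (fun z => ψ z + s • φ z) z) (metricDetVar ψ φ s z) s := by
  simp only [metricDet_add_smul hψ hφ, metricDetVar, minkowskiInner_add_left,
    minkowskiInner_add_right, minkowskiInner_smul_left, minkowskiInner_smul_right,
    minkowskiInner_comm (partialX _ _) (partialT _ _),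
    minkowskiInner_comm (partialT φ z) (partialT ψ z),
    minkowskiInner_comm (partialX φ z) (partialX ψ z)]
  generalize minkowskiInner (partialT ψ z) (partialT ψ z) = a₁
  generalize minkowskiInner (partialT ψ z) (partialX ψ z) = a₂
  generalize minkowskiInner (partialX ψ z) (partialX ψ z) = a₃
  generalize minkowskiInner (partialT ψ z) (partialT φ z) = a₄
  generalize minkowskiInner (partialT ψ z) (partialX φ z) = a₅
  generalize minkowskiInner (partialT φ z) (partialX ψ z) = a₆
  generalize minkowskiInner (partialX ψ z) (partialX φ z) = a₇
  generalize minkowskiInner (partialT φ z) (partialT φ z) = a₈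
  generalize minkowskiInner (partialT φ z) (partialX φ z) = a₉
  generalize minkowskiInner (partialX φ z) (partialX φ z) = b₁
  have hq : ∀ a b c : ℝ, HasDerivAt (fun s : ℝ => a + b * s + c * s ^ 2) (b + c * (2 * s)) s :=
    fun a b c => by
      simpa using (((hasDerivAt_id s).const_mul b).const_add a).fun_add
        (((hasDerivAt_id s).fun_pow 2).const_mul c)
  have h1 := hq a₁ (2 * a₄) a₈
  have h2 := hq a₃ (2 * a₇) b₁
  have h3 := hq a₂ (a₅ + a₆) a₉
  convert! (h1.mul h2).sub (h3.mul h3) using 1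
  · ext s; simp; ring
  · ring

theorem continuous_metricDet_add_smul (hψ : ContDiff ℝ 1 ψ) (hφ : ContDiff ℝ 1 φ) :
    Continuous fun w : ℝ × ℝ × ℝ => metricDet (fun z => ψ z + w.1 • φ z) w.2 := by
  simp only [metricDet_add_smul hψ hφ]
  have h1 := continuous_partialT hψ
  have h2 := continuous_partialX hψ
  have h3 := continuous_partialT hφ
  have h4 := continuous_partialX hφ
  have h5 : Continuous fun w : ℝ × ℝ × ℝ => partialT ψ w.2 + w.1 • partialT φ w.2 := by fun_prop
  have h6 : Continuous fun w : ℝ × ℝ × ℝ => partialX ψ w.2 + w.1 • partialX φ w.2 := by fun_prop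
  exact ((continuous_minkowskiInner h5 h5).mul (continuous_minkowskiInner h6 h6)).sub
    ((continuous_minkowskiInner h5 h6).mul (continuous_minkowskiInner h6 h5))

theorem continuous_metricDetVar (hψ : ContDiff ℝ 1 ψ) (hφ : ContDiff ℝ 1 φ) :
    Continuous fun w : ℝ × ℝ × ℝ => metricDetVar ψ φ w.1 w.2 := by
  simp only [metricDetVar]
  have h1 := continuous_partialT hψ
  have h2 := continuous_partialX hψ
  have h3 := continuous_partialT hφ
  have h4 := continuous_partialX hφ
  have h5 : Continuous fun w : ℝ × ℝ × ℝ => partialT ψ w.2 + w.1 • partialT φ w.2 := by fun_prop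
  have h6 : Continuous fun w : ℝ × ℝ × ℝ => partialX ψ w.2 + w.1 • partialX φ w.2 := by fun_prop
  have h3' : Continuous fun w : ℝ × ℝ × ℝ => partialT φ w.2 := by fun_prop
  have h4' : Continuous fun w : ℝ × ℝ × ℝ => partialX φ w.2 := by fun_prop
  exact continuous_const.mul ((((continuous_minkowskiInner h5 h3').mul
    (continuous_minkowskiInner h6 h6)).add ((continuous_minkowskiInner h5 h5).mul
    (continuous_minkowskiInner h6 h4'))).sub ((continuous_minkowskiInner h5 h6).mul
    ((continuous_minkowskiInner h6 h3').add (continuous_minkowskiInner h5 h4'))))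

/-- The derivative of the area density at `s = 0`, in terms of the conserved current. -/
theorem metricDetVar_zero {z : ℝ × ℝ} (h : metricDet ψ z < 0) :
    -metricDetVar ψ φ 0 z / (2 * Real.sqrt |metricDet ψ z|) =
    -(minkowskiInner (fluxT ψ z) (partialT φ z) +
      minkowskiInner (fluxX ψ z) (partialX φ z)) := by
  rw [abs_of_neg h]
  simp only [metricDetVar, fluxT, fluxX, zero_smul, add_zero, minkowskiInner_smul_left,
    minkowskiInner_sub_left]
  have : Real.sqrt (-metricDet ψ z) ≠ 0 := (Real.sqrt_pos.2 (neg_pos.2 h)).ne'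
  field_simp
  ring

/-- The first variation formula for the area of a timelike surface. -/
theorem hasDerivAt_minkowskiArea (hψ : ContDiff ℝ 1 ψ) (hφ : ContDiff ℝ 1 φ) (ht : IsTimelike ψ)
    {U : Set (ℝ × ℝ)} (hU : IsOpen U) (hUb : Bornology.IsBounded U) :
    HasDerivAt (fun s : ℝ => minkowskiArea (fun z => ψ z + s • φ z) U)
      (∫ z in U, -(minkowskiInner (fluxT ψ z) (partialT φ z) +
        minkowskiInner (fluxX ψ z) (partialX φ z))) 0 := by
  set G : ℝ × ℝ × ℝ → ℝ := fun w => metricDet (fun z => ψ z + w.1 • φ z) w.2 with hG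
  have hGc : Continuous G := continuous_metricDet_add_smul hψ hφ
  have hK : IsCompact (closure U) := hUb.isCompact_closure
  have hG0 : ∀ z, G (0, z) = metricDet ψ z := fun z => by simp [hG]
  -- the variations remain timelike on `U` for small `s`
  obtain ⟨V, _, hVo, -, hV0, hKV, hVG⟩ := generalized_tube_lemma (isCompact_singleton (x := (0 : ℝ)))
    hK (isOpen_lt hGc continuous_const : IsOpen {w | G w < 0}) (by
      rintro ⟨s, z⟩ ⟨hs, -⟩
      rw [mem_singleton_iff] at hs
      subst hs
      simpa [hG0] using ht z)
  obtain ⟨r, hr, hrV⟩ := Metric.isOpen_iff.1 hVo 0 (hV0 rfl)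
  have hneg : ∀ s ∈ Metric.closedBall (0 : ℝ) (r / 2), ∀ z ∈ closure U, G (s, z) < 0 :=
    fun s hs z hz => hVG ⟨hrV (Metric.closedBall_subset_ball (by linarith) hs), hKV hz⟩
  set F' : ℝ → ℝ × ℝ → ℝ := fun s z => -metricDetVar ψ φ s z / (2 * Real.sqrt |G (s, z)|) with hF'
  have hF'c : ContinuousOn (fun w : ℝ × ℝ × ℝ => F' w.1 w.2)
      (Metric.closedBall (0 : ℝ) (r / 2) ×ˢ closure U) := by
    refine ContinuousOn.div (continuous_metricDetVar hψ hφ).neg.continuousOn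
      (by fun_prop) fun w hw => ?_
    have := Real.sqrt_pos.2 (abs_pos.2 (hneg w.1 hw.1 w.2 hw.2).ne)
    positivity
  obtain ⟨C, hC⟩ := ((isCompact_closedBall (0 : ℝ) (r / 2)).prod hK).exists_bound_of_continuousOn
    hF'c
  have hF0 : ∀ z, F' 0 z = -(minkowskiInner (fluxT ψ z) (partialT φ z) +
        minkowskiInner (fluxX ψ z) (partialX φ z)) := fun z => by
    rw [← metricDetVar_zero (ht z), ← hG0]
  have hcont : Continuous fun z => -(minkowskiInner (fluxT ψ z) (partialT φ z) +
        minkowskiInner (fluxX ψ z) (partialX φ z)) :=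
    ((continuous_minkowskiInner (continuous_fluxT hψ ht) (continuous_partialT hφ)).add
      (continuous_minkowskiInner (continuous_fluxX hψ ht) (continuous_partialX hφ))).neg
  have hint : ∀ {f : ℝ × ℝ → ℝ}, Continuous f → IntegrableOn f U := fun hf =>
    (hf.continuousOn.integrableOn_compact hK).mono_set subset_closure
  have hFc : ∀ s, Continuous fun z => Real.sqrt |G (s, z)| := fun s => by fun_prop
  have key := hasDerivAt_integral_of_dominated_loc_of_deriv_le (μ := volume.restrict U)
    (F := fun s z => Real.sqrt |G (s, z)|) (F' := F') (x₀ := 0) (bound := fun _ => C)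
    (Metric.ball_mem_nhds (0 : ℝ) (half_pos hr))
    (Filter.Eventually.of_forall fun s => (hFc s).aestronglyMeasurable) (hint (hFc 0))
    (by simp only [funext hF0]; exact hcont.aestronglyMeasurable)
    (ae_restrict_of_forall_mem hU.measurableSet fun z hz s hs =>
      hC (s, z) ⟨Metric.ball_subset_closedBall hs, subset_closure hz⟩)
    (hint continuous_const)
    (ae_restrict_of_forall_mem hU.measurableSet fun z hz s hs => by
      have hlt := hneg s (Metric.ball_subset_closedBall hs) z (subset_closure hz)
      have h1 : HasDerivAt (fun s => |G (s, z)|) (-1 * metricDetVar ψ φ s z) s :=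
        HasDerivAt.comp (h₂ := fun x : ℝ => |x|) s (hasDerivAt_abs_neg hlt)
          (hasDerivAt_metricDet hψ hφ s z)
      have h2 := h1.sqrt (abs_pos.2 hlt.ne).ne'
      rw [neg_one_mul] at h2
      exact h2)
  have h2 := key.2
  simp only [hF0] at h2
  exact h2

theorem partials_eq_zero_of_notMem (z : ℝ × ℝ) (hz : z ∉ tsupport φ) :
    partialT φ z = 0 ∧ partialX φ z = 0 := by
  have : fderiv ℝ φ z = 0 := by
    by_contra h
    exact hz (support_fderiv_subset ℝ h)
  simp [partialT, partialX, this]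

/-- A timelike surface is extremal if and only if its variation current is weakly conserved. -/
theorem isExtremal_iff (hψ : ContDiff ℝ 1 ψ) (ht : IsTimelike ψ) :
    IsExtremal ψ ↔ ∀ φ : ℝ × ℝ → Minkowski n, ContDiff ℝ 1 φ → HasCompactSupport φ →
      ∫ z, (minkowskiInner (fluxT ψ z) (partialT φ z) +
        minkowskiInner (fluxX ψ z) (partialX φ z)) = 0 := by
  have hset : ∀ φ : ℝ × ℝ → Minkowski n, ∀ U, tsupport φ ⊆ U →
      ∫ z in U, -(minkowskiInner (fluxT ψ z) (partialT φ z) +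
        minkowskiInner (fluxX ψ z) (partialX φ z)) =
      -∫ z, (minkowskiInner (fluxT ψ z) (partialT φ z) +
        minkowskiInner (fluxX ψ z) (partialX φ z)) := fun φ U hU => by
    rw [integral_neg, setIntegral_eq_integral_of_forall_compl_eq_zero]
    intro z hz
    obtain ⟨h1, h2⟩ := partials_eq_zero_of_notMem (φ := φ) z fun h => hz (hU h)
    simp [h1, h2, minkowskiInner]
  constructor
  · intro h φ hφ hs
    obtain ⟨R, -, hR⟩ := hs.isBounded.subset_ball_lt 0 0
    have h1 := h φ hφ hs _ Metric.isOpen_ball Metric.isBounded_ball hR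
    have h2 := h1.unique (hasDerivAt_minkowskiArea hψ hφ ht Metric.isOpen_ball
      (Metric.isBounded_ball (x := (0 : ℝ × ℝ)) (r := R)))
    rw [hset φ _ hR] at h2
    linarith
  · intro h φ hφ hs U hU hUb hsU
    have := hasDerivAt_minkowskiArea hψ hφ ht hU hUb
    rwa [hset φ U hsU, h φ hφ hs, neg_zero] at this

theorem IsExtremal.isWeaklyDivFree (hψ : ContDiff ℝ 1 ψ) (ht : IsTimelike ψ) (h : IsExtremal ψ)
    (e : Minkowski n) : IsWeaklyDivFree (fun z => minkowskiInner (fluxT ψ z) e)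
      (fun z => minkowskiInner (fluxX ψ z) e) := by
  intro η hη hs
  have h1 := (isExtremal_iff hψ ht).1 h (fun z => η z • e) (hη.smul contDiff_const)
    (hs.smul_right)
  refine Eq.trans (integral_congr_ae (Filter.Eventually.of_forall fun z => ?_)) h1
  have h2 : ∀ v, fderiv ℝ (fun z => η z • e) z v = fderiv ℝ η z v • e := fun v => by
    rw [fderiv_smul_const (hη.differentiable one_ne_zero z)]; simp
  simp only [partialT, partialX, h2, minkowskiInner_smul_right]
  ring

/-- Conservation of all the components of the current suffices for extremality. -/
theorem isExtremal_of_isWeaklyDivFree (hψ : ContDiff ℝ 1 ψ) (ht : IsTimelike ψ)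
    (h0 : IsWeaklyDivFree (fun z => (fluxT ψ z).1) fun z => (fluxX ψ z).1)
    (hi : ∀ i, IsWeaklyDivFree (fun z => (fluxT ψ z).2 i) fun z => (fluxX ψ z).2 i) :
    IsExtremal ψ := by
  rw [isExtremal_iff hψ ht]
  intro φ hφ hs
  have cT := continuous_fluxT hψ ht
  have cX := continuous_fluxX hψ ht
  have e0 : ∀ z v, (fderiv ℝ φ z v).1 = fderiv ℝ (fun z => (φ z).1) z v := fun z v => by
    rw [fderiv.fst (hφ.differentiable one_ne_zero z)]; rfl
  have ei : ∀ i z v, (fderiv ℝ φ z v).2 i = fderiv ℝ (fun z => (φ z).2 i) z v := fun i z v => by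
    have h1 : HasFDerivAt (fun z => (φ z).2 i) ((EuclideanSpace.proj i).comp
        ((ContinuousLinearMap.snd ℝ ℝ (Space n)).comp (fderiv ℝ φ z))) z :=
      ((EuclideanSpace.proj (𝕜 := ℝ) i).comp
        (ContinuousLinearMap.snd ℝ ℝ (Space n))).hasFDerivAt.comp z
        (hφ.differentiable one_ne_zero z).hasFDerivAt
    rw [h1.fderiv]; rfl
  have d0 : ContDiff ℝ 1 fun z => (φ z).1 := hφ.fst
  have di : ∀ i, ContDiff ℝ 1 fun z => (φ z).2 i := fun i =>
    (EuclideanSpace.proj (𝕜 := ℝ) i).contDiff.comp hφ.snd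
  have s0 : HasCompactSupport fun z => (φ z).1 := hs.comp_left (g := Prod.fst) rfl
  have si : ∀ i, HasCompactSupport fun z => (φ z).2 i := fun i =>
    hs.comp_left (g := fun X : Minkowski n => X.2 i) rfl
  have hint : ∀ {f η : ℝ × ℝ → ℝ} (v : ℝ × ℝ), Continuous f → ContDiff ℝ 1 η →
      HasCompactSupport η → Integrable fun z => f z * fderiv ℝ η z v := fun v hf hη hs =>
    (hf.mul (continuous_fderiv_apply_const hη v)).integrable_of_hasCompactSupport
      (hasCompactSupport_fderiv_apply hs v).mul_left
  have cTi : ∀ i, Continuous fun z => (fluxT ψ z).2 i := fun i =>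
    (EuclideanSpace.proj (𝕜 := ℝ) i).continuous.comp cT.snd
  have cXi : ∀ i, Continuous fun z => (fluxX ψ z).2 i := fun i =>
    (EuclideanSpace.proj (𝕜 := ℝ) i).continuous.comp cX.snd
  have key : ∀ z, minkowskiInner (fluxT ψ z) (partialT φ z) +
      minkowskiInner (fluxX ψ z) (partialX φ z) =
      -((fluxT ψ z).1 * fderiv ℝ (fun z => (φ z).1) z (1, 0) +
        (fluxX ψ z).1 * fderiv ℝ (fun z => (φ z).1) z (0, 1)) +
      ∑ i, ((fluxT ψ z).2 i * fderiv ℝ (fun z => (φ z).2 i) z (1, 0) +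
        (fluxX ψ z).2 i * fderiv ℝ (fun z => (φ z).2 i) z (0, 1)) := fun z => by
    simp only [minkowskiInner_eq_sum, partialT, partialX, e0, ei, Finset.sum_add_distrib]
    ring
  simp only [key]
  have i0 : Integrable fun z => (fluxT ψ z).1 * fderiv ℝ (fun z => (φ z).1) z (1, 0) +
      (fluxX ψ z).1 * fderiv ℝ (fun z => (φ z).1) z (0, 1) :=
    (hint (1, 0) cT.fst d0 s0).add (hint (0, 1) cX.fst d0 s0)
  have ii : ∀ i, Integrable fun z => (fluxT ψ z).2 i * fderiv ℝ (fun z => (φ z).2 i) z (1, 0) +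
      (fluxX ψ z).2 i * fderiv ℝ (fun z => (φ z).2 i) z (0, 1) := fun i =>
    (hint (1, 0) (cTi i) (di i) (si i)).add (hint (0, 1) (cXi i) (di i) (si i))
  rw [integral_add i0.fun_neg (integrable_finsetSum _ fun i _ => ii i), integral_neg, h0 _ d0 s0,
    integral_finsetSum _ fun i _ => ii i]
  simp [fun i => hi i _ (di i) (si i)]

end Variation

/-! ### The null directions of a couple -/

namespace PeriodicCouple

/-- The vector `√(1 - |v₀|²) γ₀' / |γ₀'|`. -/
def tangent (c : PeriodicCouple n) (x : ℝ) : Space n :=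
  (Real.sqrt (1 - ‖c.velocity x‖ ^ 2) * ‖deriv c.curve x‖⁻¹) • deriv c.curve x

/-- The spatial part `v₀ + τ` of one null direction of the plane spanned by `(1, v₀)` and
`(0, γ₀')`, where `τ` is `tangent`. -/
def nullPlus (c : PeriodicCouple n) (x : ℝ) : Space n := c.velocity x + c.tangent x

/-- The spatial part `v₀ - τ` of the other null direction of the plane spanned by `(1, v₀)` and
`(0, γ₀')`, where `τ` is `tangent`. -/
def nullMinus (c : PeriodicCouple n) (x : ℝ) : Space n := c.velocity x - c.tangent x

/-- The density `|γ₀'| / √(1 - |v₀|²)` of the energy of the couple. -/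
def energyDensity (c : PeriodicCouple n) (x : ℝ) : ℝ :=
  ‖deriv c.curve x‖ / Real.sqrt (1 - ‖c.velocity x‖ ^ 2)

variable (c : PeriodicCouple n)

theorem one_sub_sq_pos (x : ℝ) : 0 < 1 - ‖c.velocity x‖ ^ 2 := by
  have := c.subluminal x
  nlinarith [norm_nonneg (c.velocity x)]

theorem continuous_deriv_curve : Continuous (deriv c.curve) :=
  c.contDiff_curve.continuous_deriv le_rfl

theorem hasDerivAt_curve (x : ℝ) : HasDerivAt c.curve (deriv c.curve x) x :=
  (c.contDiff_curve.differentiable one_ne_zero x).hasDerivAt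

theorem continuous_tangent : Continuous c.tangent := by
  have h1 := c.continuous_velocity
  have h2 := c.continuous_deriv_curve
  refine Continuous.smul (Continuous.mul (by fun_prop) (h2.norm.inv₀ fun x => ?_)) h2
  exact norm_ne_zero_iff.2 (c.immersion x)

theorem continuous_nullPlus : Continuous c.nullPlus :=
  c.continuous_velocity.add c.continuous_tangent

theorem continuous_nullMinus : Continuous c.nullMinus :=
  c.continuous_velocity.sub c.continuous_tangent

theorem continuous_energyDensity : Continuous c.energyDensity := by
  have h1 := c.continuous_velocity
  have h2 := c.continuous_deriv_curve
  exact h2.norm.div (by fun_prop) fun x => (Real.sqrt_pos.2 (c.one_sub_sq_pos x)).ne'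

theorem energyDensity_pos (x : ℝ) : 0 < c.energyDensity x :=
  div_pos (norm_pos_iff.2 (c.immersion x)) (Real.sqrt_pos.2 (c.one_sub_sq_pos x))

theorem norm_tangent_sq (x : ℝ) : ‖c.tangent x‖ ^ 2 = 1 - ‖c.velocity x‖ ^ 2 := by
  have h := norm_pos_iff.2 (c.immersion x)
  rw [tangent, norm_smul, mul_pow, Real.norm_eq_abs, sq_abs, mul_pow,
    Real.sq_sqrt (c.one_sub_sq_pos x).le]
  field_simp

theorem inner_velocity_tangent (x : ℝ) : inner ℝ (c.velocity x) (c.tangent x) = 0 := by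
  rw [tangent, inner_smul_right, c.orthogonal, mul_zero]

theorem deriv_curve_eq (x : ℝ) : deriv c.curve x = c.energyDensity x • c.tangent x := by
  have h := norm_pos_iff.2 (c.immersion x)
  have h2 := Real.sqrt_pos.2 (c.one_sub_sq_pos x)
  rw [tangent, smul_smul, energyDensity]
  rw [show ‖deriv c.curve x‖ / Real.sqrt (1 - ‖c.velocity x‖ ^ 2) *
    (Real.sqrt (1 - ‖c.velocity x‖ ^ 2) * ‖deriv c.curve x‖⁻¹) = 1 by field_simp, one_smul]

theorem tangent_ne_zero (x : ℝ) : c.tangent x ≠ 0 := fun h =>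
  c.immersion x (by rw [c.deriv_curve_eq, h, smul_zero])

theorem norm_nullPlus (x : ℝ) : ‖c.nullPlus x‖ = 1 := by
  rw [← sq_eq_sq₀ (norm_nonneg _) zero_le_one, nullPlus, norm_add_sq_real,
    c.inner_velocity_tangent, c.norm_tangent_sq]
  ring

theorem norm_nullMinus (x : ℝ) : ‖c.nullMinus x‖ = 1 := by
  rw [← sq_eq_sq₀ (norm_nonneg _) zero_le_one, nullMinus, norm_sub_sq_real,
    c.inner_velocity_tangent, c.norm_tangent_sq]
  ring

theorem nullPlus_sub_nullMinus (x : ℝ) : c.nullPlus x - c.nullMinus x = (2 : ℝ) • c.tangent x := by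
  rw [nullPlus, nullMinus, two_smul]; abel

theorem nullPlus_add_nullMinus (x : ℝ) :
    c.nullPlus x + c.nullMinus x = (2 : ℝ) • c.velocity x := by
  rw [nullPlus, nullMinus, two_smul]; abel

theorem nullPlus_ne_nullMinus (x : ℝ) : c.nullPlus x ≠ c.nullMinus x := fun h => by
  have := c.nullPlus_sub_nullMinus x
  rw [h, sub_self, eq_comm, smul_eq_zero] at this
  exact c.tangent_ne_zero x (this.resolve_left two_ne_zero)

theorem periodic_deriv {L : ℝ} (h : Function.Periodic c.curve L) :
    Function.Periodic (deriv c.curve) L := fun x => by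
  rw [← deriv_comp_add_const]
  exact congrArg (deriv · x) (funext h)

variable {c} in
theorem periodic_tangent {L : ℝ} (h : Function.Periodic c.curve L)
    (h' : Function.Periodic c.velocity L) : Function.Periodic c.tangent L := fun x => by
  rw [tangent, tangent, h' x, c.periodic_deriv h x]

variable {c} in
theorem periodic_nullPlus {L : ℝ} (h : Function.Periodic c.curve L)
    (h' : Function.Periodic c.velocity L) : Function.Periodic c.nullPlus L := fun x => by
  rw [nullPlus, nullPlus, h' x, periodic_tangent h h' x]

variable {c} in
theorem periodic_nullMinus {L : ℝ} (h : Function.Periodic c.curve L)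
    (h' : Function.Periodic c.velocity L) : Function.Periodic c.nullMinus L := fun x => by
  rw [nullMinus, nullMinus, h' x, periodic_tangent h h' x]

variable {c} in
theorem periodic_energyDensity {L : ℝ} (h : Function.Periodic c.curve L)
    (h' : Function.Periodic c.velocity L) : Function.Periodic c.energyDensity L := fun x => by
  rw [energyDensity, energyDensity, h' x, c.periodic_deriv h x]

end PeriodicCouple

/-! ### Rigidity of extremal cylinders -/

theorem surjective_of_map_add {f : ℝ → ℝ} {E C : ℝ} (hf : Continuous f) (hC : 0 < C)
    (h : ∀ x, f (x + E) = f x + C) : Function.Surjective f := by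
  have h1 : ∀ k : ℕ, f (k * E) = f 0 + k * C := fun k => by
    induction k with
    | zero => simp
    | succ k ih => rw [Nat.cast_succ, add_mul, one_mul, h, ih]; ring
  have h2 : ∀ k : ℕ, f (-(k * E)) = f 0 - k * C := fun k => by
    induction k with
    | zero => simp
    | succ k ih =>
      have := h (-((k + 1 : ℕ) * E))
      rw [show -((k + 1 : ℕ) * E) + E = -(k * E) by push_cast; ring, ih] at this
      push_cast at this ⊢
      linarith
  intro y
  obtain ⟨k, hk⟩ := exists_nat_gt (|y - f 0| / C)
  rw [div_lt_iff₀ hC] at hk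
  have h3 := abs_lt.1 hk
  exact mem_range_of_exists_le_of_exists_ge hf ⟨_, by rw [h2 k]; linarith⟩
    ⟨_, by rw [h1 k]; linarith⟩

/-- If `df = k d(X + σ t)`, where `(t, X)` is a global coordinate system of the plane, then `k`
only depends on `X + σ t`. -/
theorem eq_of_null_coordinate_eq {X f k a b : ℝ × ℝ → ℝ} {σ : ℝ}
    (hX : ∀ z, HasStrictFDerivAt X (ofPartials (a z) (b z)) z) (hb : ∀ z, 0 < b z)
    (hsurj : ∀ t, Function.Surjective fun x => X (t, x))
    (hf : ∀ z, HasFDerivAt f (ofPartials (k z * (a z + σ)) (k z * b z)) z)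
    {z w : ℝ × ℝ} (hzw : X z + σ * z.1 = X w + σ * w.1) : k z = k w := by
  set Φ : ℝ × ℝ → ℝ × ℝ := fun z => (z.1, X z) with hΦ
  have hmono : ∀ t, StrictMono fun x => X (t, x) := fun t =>
    strictMono_of_hasDerivAt_pos (fun x => by
      have h1 : HasDerivAt (fun x : ℝ => (t, x)) ((0 : ℝ), (1 : ℝ)) x :=
        (hasDerivAt_const x t).prodMk (hasDerivAt_id x)
      have h2 : HasDerivAt (fun x => X (t, x)) _ x :=
        (hX (t, x)).hasFDerivAt.comp_hasDerivAt x h1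
      simpa using h2) fun x => hb (t, x)
  have hbij : Function.Bijective Φ := by
    constructor
    · rintro ⟨t, x⟩ ⟨t', x'⟩ h
      obtain ⟨rfl, h2⟩ := Prod.mk.inj h
      rw [(hmono t).injective h2]
    · rintro ⟨t, y⟩
      obtain ⟨x, hx⟩ := hsurj t y
      exact ⟨(t, x), Prod.ext rfl hx⟩
  let D : ℝ × ℝ → ((ℝ × ℝ) ≃L[ℝ] (ℝ × ℝ)) := fun z => ContinuousLinearEquiv.equivOfInverse
    ((ContinuousLinearMap.fst ℝ ℝ ℝ).prod (ofPartials (a z) (b z)))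
    ((ContinuousLinearMap.fst ℝ ℝ ℝ).prod (ofPartials (-(a z) / b z) (1 / b z)))
    (fun v => by
      have := (hb z).ne'
      ext
      · simp
      · simp; field_simp; ring)
    (fun v => by
      have := (hb z).ne'
      ext
      · simp
      · simp; field_simp; ring)
  have hΦd : ∀ z, HasStrictFDerivAt Φ (D z : ℝ × ℝ →L[ℝ] ℝ × ℝ) z := fun z =>
    hasStrictFDerivAt_fst.prodMk (hX z)
  have hΦc : Continuous Φ := continuous_iff_continuousAt.2 fun z => (hΦd z).continuousAt
  let H : ℝ × ℝ ≃ₜ ℝ × ℝ := (Equiv.ofBijective Φ hbij).toHomeomorphOfContinuousOpen hΦc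
    (isOpenMap_of_hasStrictFDerivAt_equiv hΦd)
  have hH : ∀ z, H z = Φ z := fun z => rfl
  have hHs : ∀ y, HasFDerivAt (f ∘ H.symm) ((ofPartials (k (H.symm y) * (a (H.symm y) + σ))
      (k (H.symm y) * b (H.symm y))).comp ((D (H.symm y)).symm : ℝ × ℝ →L[ℝ] ℝ × ℝ)) y := fun y =>
    (hf (H.symm y)).comp y (HasFDerivAt.of_local_left_inverse H.symm.continuous.continuousAt
      (hΦd _).hasFDerivAt (Filter.Eventually.of_forall fun y => H.apply_symm_apply y))
  have hDs : ∀ z v, (D z).symm v = (v.1, v.1 * (-(a z) / b z) + v.2 * (1 / b z)) := fun z v => by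
    change ((ContinuousLinearMap.fst ℝ ℝ ℝ).prod (ofPartials (-(a z) / b z) (1 / b z))) v = _
    simp
  -- in the coordinates `(t, X)`, `f` is constant along the lines `X + σ t = const`
  have hconst : ∀ s t, (f ∘ H.symm) (t, s - σ * t) = (f ∘ H.symm) (0, s) := fun s t => by
    have h1 : ∀ t, HasDerivAt (fun t => (f ∘ H.symm) (t, s - σ * t)) 0 t := fun t => by
      have h2 : HasDerivAt (fun t => (t, s - σ * t)) (1, -σ) t :=
        (hasDerivAt_id t).prodMk (by simpa using ((hasDerivAt_id t).const_mul σ).const_sub s)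
      have h3 := (hHs (t, s - σ * t)).comp_hasDerivAt t h2
      have h4 := (hb (H.symm (t, s - σ * t))).ne'
      convert! h3 using 1
      simp [hDs]
      field_simp
      ring
    have := is_const_of_deriv_eq_zero (fun t => (h1 t).differentiableAt) (fun t => (h1 t).deriv) t 0
    simpa using this
  have hder : ∀ t s, HasDerivAt (fun s => (f ∘ H.symm) (0, s)) (k (H.symm (t, s - σ * t))) s :=
    fun t s => by
      have h2 : HasDerivAt (fun s => (t, s - σ * t)) ((0 : ℝ), (1 : ℝ)) s :=
        (hasDerivAt_const s t).prodMk ((hasDerivAt_id s).sub_const (σ * t))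
      have h3 := (hHs (t, s - σ * t)).comp_hasDerivAt s h2
      have h4 := (hb (H.symm (t, s - σ * t))).ne'
      refine (h3.congr_of_eventuallyEq (Filter.Eventually.of_forall fun s =>
        (hconst s t).symm)).congr_deriv ?_
      simp [hDs]
      field_simp
  have hval : ∀ z : ℝ × ℝ, H.symm (z.1, X z + σ * z.1 - σ * z.1) = z := fun z => by
    rw [add_sub_cancel_right]
    exact H.symm_apply_apply z
  have h1 := hder z.1 (X z + σ * z.1)
  have h2 := hder w.1 (X z + σ * z.1)
  rw [hval] at h1
  rw [hzw, hval, ← hzw] at h2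
  exact h1.unique h2

section Graph

variable {γ : ℝ × ℝ → Space n}

theorem hasFDerivAt_graphMap (hγ : ContDiff ℝ 1 γ) (z : ℝ × ℝ) :
    HasFDerivAt (graphMap γ) ((ContinuousLinearMap.fst ℝ ℝ ℝ).prod (fderiv ℝ γ z)) z :=
  hasFDerivAt_fst.prodMk (hγ.differentiable one_ne_zero z).hasFDerivAt

theorem contDiff_graphMap (hγ : ContDiff ℝ 1 γ) : ContDiff ℝ 1 (graphMap γ) :=
  contDiff_fst.prodMk hγ

theorem partialT_graphMap (hγ : ContDiff ℝ 1 γ) (z : ℝ × ℝ) :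
    partialT (graphMap γ) z = (1, fderiv ℝ γ z (1, 0)) := by
  rw [partialT, (hasFDerivAt_graphMap hγ z).fderiv]; rfl

theorem partialX_graphMap (hγ : ContDiff ℝ 1 γ) (z : ℝ × ℝ) :
    partialX (graphMap γ) z = (0, fderiv ℝ γ z (0, 1)) := by
  rw [partialX, (hasFDerivAt_graphMap hγ z).fderiv]; rfl

theorem metricDet_graphMap (hγ : ContDiff ℝ 1 γ) (z : ℝ × ℝ) :
    metricDet (graphMap γ) z = (-1 + ‖fderiv ℝ γ z (1, 0)‖ ^ 2) * ‖fderiv ℝ γ z (0, 1)‖ ^ 2 -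
      inner ℝ (fderiv ℝ γ z (1, 0)) (fderiv ℝ γ z (0, 1)) ^ 2 := by
  simp only [metricDet, partialT_graphMap hγ, partialX_graphMap hγ, minkowskiInner,
    real_inner_self_eq_norm_sq, real_inner_comm (fderiv ℝ γ z (1, 0)) (fderiv ℝ γ z (0, 1))]
  ring

theorem fluxT_graphMap (hγ : ContDiff ℝ 1 γ) (z : ℝ × ℝ) :
    fluxT (graphMap γ) z = (Real.sqrt (-metricDet (graphMap γ) z))⁻¹ •
      (‖fderiv ℝ γ z (0, 1)‖ ^ 2, ‖fderiv ℝ γ z (0, 1)‖ ^ 2 • fderiv ℝ γ z (1, 0) -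
        inner ℝ (fderiv ℝ γ z (1, 0)) (fderiv ℝ γ z (0, 1)) • fderiv ℝ γ z (0, 1)) := by
  simp [fluxT, partialT_graphMap hγ, partialX_graphMap hγ, minkowskiInner]

theorem fluxX_graphMap (hγ : ContDiff ℝ 1 γ) (z : ℝ × ℝ) :
    fluxX (graphMap γ) z = (Real.sqrt (-metricDet (graphMap γ) z))⁻¹ •
      (-inner ℝ (fderiv ℝ γ z (1, 0)) (fderiv ℝ γ z (0, 1)),
        (-1 + ‖fderiv ℝ γ z (1, 0)‖ ^ 2) • fderiv ℝ γ z (0, 1) -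
        inner ℝ (fderiv ℝ γ z (1, 0)) (fderiv ℝ γ z (0, 1)) • fderiv ℝ γ z (1, 0)) := by
  simp [fluxX, partialT_graphMap hγ, partialX_graphMap hγ, minkowskiInner]

end Graph

/-- The velocity of the surface `(t, γ(t, x))` normal to the curve `γ(t, ·)`. -/
def normalVelocity (γ : ℝ × ℝ → Space n) (z : ℝ × ℝ) : Space n :=
  fderiv ℝ γ z (1, 0) - (inner ℝ (fderiv ℝ γ z (1, 0)) (fderiv ℝ γ z (0, 1)) /
    ‖fderiv ℝ γ z (0, 1)‖ ^ 2) • fderiv ℝ γ z (0, 1)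

/-- The tangent vector to the curve `γ(t, ·)` whose sum with the normal velocity is a unit
vector. -/
def scaledTangent (γ : ℝ × ℝ → Space n) (z : ℝ × ℝ) : Space n :=
  (Real.sqrt (-metricDet (graphMap γ) z) / ‖fderiv ℝ γ z (0, 1)‖ ^ 2) • fderiv ℝ γ z (0, 1)

theorem fderiv_periodic {γ : ℝ × ℝ → Space n} {E : ℝ}
    (h : ∀ t x : ℝ, γ (t, x + E) = γ (t, x)) (t x : ℝ) :
    fderiv ℝ γ (t, x + E) = fderiv ℝ γ (t, x) := by
  have h1 : (fun z => γ (z + (0, E))) = γ := by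
    funext ⟨t, x⟩; simpa using h t x
  have h2 := fderiv_comp_add_right (𝕜 := ℝ) (f := γ) (x := (t, x)) (0, E)
  rw [h1] at h2
  rw [h2]; simp

theorem norm_partial_pos {γ : ℝ × ℝ → Space n} (hγ : ContDiff ℝ 1 γ)
    (ht : IsTimelike (graphMap γ)) (z : ℝ × ℝ) : 0 < ‖fderiv ℝ γ z (0, 1)‖ := by
  have h := ht z
  rw [metricDet_graphMap hγ] at h
  rw [norm_pos_iff]
  intro h0
  simp [h0] at h

/-- On a timelike extremal cylinder the time function has a harmonic conjugate `X`, with which it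
forms global isothermal coordinates. The two null vector fields only depend on the null coordinates
`X + t` and `X - t` respectively. -/
theorem IsTimelikeExtremalCylinder.exists_null_coordinates {γ : ℝ × ℝ → Space n}
    (h : IsTimelikeExtremalCylinder γ) :
    ∃ X : ℝ × ℝ → ℝ, (∀ t, Function.Surjective fun x => X (t, x)) ∧
      (∀ z w, X z + z.1 = X w + w.1 →
        normalVelocity γ z + scaledTangent γ z = normalVelocity γ w + scaledTangent γ w) ∧
      (∀ z w, X z - z.1 = X w - w.1 →
        normalVelocity γ z - scaledTangent γ z = normalVelocity γ w - scaledTangent γ w) := by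
  obtain ⟨hγ, ⟨E, hE, hper⟩, ht, hext⟩ := h
  have hψ := contDiff_graphMap hγ
  have cT := continuous_fluxT hψ ht
  have cX := continuous_fluxX hψ ht
  have hD : ∀ z, 0 < Real.sqrt (-metricDet (graphMap γ) z) := fun z =>
    Real.sqrt_pos.2 (neg_pos.2 (ht z))
  have hgx := norm_partial_pos hγ ht
  -- the conjugate of the time function
  obtain ⟨X, hX⟩ : ∃ X : ℝ × ℝ → ℝ, ∀ z, HasStrictFDerivAt X (ofPartials
      (-(fluxX (graphMap γ) z).1) ((fluxT (graphMap γ) z).1)) z := by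
    have := hext.isWeaklyDivFree hψ ht (-1, 0)
    simp only [minkowskiInner, inner_zero_right, add_zero, mul_neg, mul_one, neg_neg] at this
    exact this.exists_potential cT.fst cX.fst
  have hb : ∀ z, 0 < (fluxT (graphMap γ) z).1 := fun z => by
    rw [fluxT_graphMap hγ]
    have := hD z
    have := hgx z
    simp only [Prod.smul_mk, smul_eq_mul]
    positivity
  have hXx : ∀ t x, HasDerivAt (fun x => X (t, x)) ((fluxT (graphMap γ) (t, x)).1) x := fun t x => by
    have h1 : HasDerivAt (fun x : ℝ => (t, x)) ((0 : ℝ), (1 : ℝ)) x :=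
      (hasDerivAt_const x t).prodMk (hasDerivAt_id x)
    have h2 : HasDerivAt (fun x => X (t, x)) _ x :=
      (hX (t, x)).hasFDerivAt.comp_hasDerivAt x h1
    simpa using h2
  have hfper : ∀ t x, (fluxT (graphMap γ) (t, x + E)).1 = (fluxT (graphMap γ) (t, x)).1 :=
    fun t x => by
      simp only [fluxT_graphMap hγ, metricDet_graphMap hγ, fderiv_periodic hper]
  have hsurj : ∀ t, Function.Surjective fun x => X (t, x) := fun t => by
    have hc : Continuous fun x => X (t, x) :=
      continuous_iff_continuousAt.2 fun x => (hXx t x).continuousAt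
    have hmono : StrictMono fun x => X (t, x) :=
      strictMono_of_hasDerivAt_pos (hXx t) fun x => hb (t, x)
    refine surjective_of_map_add (E := E) (C := X (t, 0 + E) - X (t, 0)) hc
      (sub_pos.2 (hmono (by linarith))) fun x => ?_
    have hd : ∀ x, HasDerivAt (fun x => X (t, x + E) - X (t, x)) 0 x := fun x => by
      have h1 := ((hXx t (x + E)).comp_add_const x E).sub (hXx t x)
      rw [hfper, sub_self] at h1
      exact h1
    have := is_const_of_deriv_eq_zero (fun t => (hd t).differentiableAt) (fun t => (hd t).deriv) x 0
    linarith
  -- the conjugates of the space coordinates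
  have hW : ∀ i, ∃ W : ℝ × ℝ → ℝ, ∀ z, HasStrictFDerivAt W (ofPartials
      (-(fluxX (graphMap γ) z).2 i) ((fluxT (graphMap γ) z).2 i)) z := fun i => by
    have := hext.isWeaklyDivFree hψ ht (0, EuclideanSpace.single i 1)
    simp only [minkowskiInner, mul_zero, neg_zero, zero_add, EuclideanSpace.inner_single_right,
      one_mul, conj_trivial] at this
    exact this.exists_potential ((EuclideanSpace.proj (𝕜 := ℝ) i).continuous.comp cT.snd)
      ((EuclideanSpace.proj (𝕜 := ℝ) i).continuous.comp cX.snd)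
  have hγi : ∀ i z, HasFDerivAt (fun z => γ z i)
      (ofPartials (fderiv ℝ γ z (1, 0) i) (fderiv ℝ γ z (0, 1) i)) z := fun i z => by
    have h1 : HasFDerivAt (fun z => γ z i) ((EuclideanSpace.proj i).comp (fderiv ℝ γ z)) z :=
      (EuclideanSpace.proj (𝕜 := ℝ) i).hasFDerivAt.comp z
        (hγ.differentiable one_ne_zero z).hasFDerivAt
    rw [← ofPartials_eta (ContinuousLinearMap.comp _ _)] at h1
    exact h1
  have hDsq : ∀ z, Real.sqrt (-metricDet (graphMap γ) z) ^ 2 =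
      inner ℝ (fderiv ℝ γ z (1, 0)) (fderiv ℝ γ z (0, 1)) ^ 2 -
      (-1 + ‖fderiv ℝ γ z (1, 0)‖ ^ 2) * ‖fderiv ℝ γ z (0, 1)‖ ^ 2 := fun z => by
    rw [Real.sq_sqrt (neg_pos.2 (ht z)).le, metricDet_graphMap hγ]; ring
  have key : ∀ i, ∀ σ : ℝ, σ * σ = 1 → ∀ z w, X z + σ * z.1 = X w + σ * w.1 →
      normalVelocity γ z i + σ * scaledTangent γ z i =
        normalVelocity γ w i + σ * scaledTangent γ w i := fun i σ hσ z w hzw => by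
    obtain ⟨W, hW⟩ := hW i
    refine eq_of_null_coordinate_eq (f := fun z => γ z i * σ + W z)
      (k := fun z => normalVelocity γ z i + σ * scaledTangent γ z i) hX hb hsurj (fun z => ?_) hzw
    have h1 := ((hγi i z).mul_const σ).add (hW z).hasFDerivAt
    convert! h1 using 1
    have hD' := hD z
    have hg' := hgx z
    have hq := hDsq z
    rw [fluxX_graphMap hγ, fluxT_graphMap hγ]
    simp only [normalVelocity, scaledTangent]
    generalize Real.sqrt (-metricDet (graphMap γ) z) = d at *
    generalize inner ℝ (fderiv ℝ γ z (1, 0)) (fderiv ℝ γ z (0, 1)) = m at *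
    generalize ‖fderiv ℝ γ z (0, 1)‖ = r at *
    generalize -1 + ‖fderiv ℝ γ z (1, 0)‖ ^ 2 = q at *
    ext
    · simp
      field_simp
      linear_combination fderiv ℝ γ z (0, 1) i * hq + fderiv ℝ γ z (0, 1) i * d ^ 2 * hσ
    · simp
      field_simp
      ring
  refine ⟨X, hsurj, fun z w hzw => ?_, fun z w hzw => ?_⟩
  · ext i
    simpa using key i 1 (by norm_num) z w (by simpa using hzw)
  · ext i
    simpa [sub_eq_add_neg] using key i (-1) (by norm_num) z w (by simpa [sub_eq_add_neg] using hzw)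

/-- At time `0`, the normal velocity and the scaled tangent of a cylinder tangent to `(1, v₀)` are
those of the couple: `v₀` is normal to the curve. -/
theorem normalVelocity_eq {c : PeriodicCouple n} {γ : ℝ × ℝ → Space n} (hγ : ContDiff ℝ 1 γ)
    (ht : IsTimelike (graphMap γ)) (h0 : ∀ x, γ (0, x) = c.curve x) {x : ℝ}
    (hx : ((1, c.velocity x) : Minkowski n) ∈ Set.range (fderiv ℝ (graphMap γ) (0, x))) :
    normalVelocity γ (0, x) = c.velocity x ∧ scaledTangent γ (0, x) = c.tangent x := by
  have hgx := norm_partial_pos hγ ht (0, x)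
  have hc : deriv c.curve x = fderiv ℝ γ (0, x) (0, 1) := by
    have h1 : HasDerivAt (fun x : ℝ => ((0 : ℝ), x)) ((0 : ℝ), (1 : ℝ)) x :=
      (hasDerivAt_const x 0).prodMk (hasDerivAt_id x)
    have h2 : HasDerivAt (fun x => γ (0, x)) _ x :=
      (hγ.differentiable one_ne_zero (0, x)).hasFDerivAt.comp_hasDerivAt x h1
    rw [funext h0] at h2
    exact h2.deriv
  obtain ⟨⟨r, s⟩, hrs⟩ := hx
  rw [(hasFDerivAt_graphMap hγ _).fderiv] at hrs
  obtain ⟨h1, h2⟩ := Prod.mk.inj hrs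
  change r = 1 at h1
  subst h1
  rw [← ofPartials_eta (fderiv ℝ γ (0, x))] at h2
  replace h2 : fderiv ℝ γ (0, x) (1, 0) + s • fderiv ℝ γ (0, x) (0, 1) = c.velocity x := by
    simpa using h2
  have horth := c.orthogonal x
  have hsq := c.one_sub_sq_pos x
  have hD := metricDet_graphMap hγ (0, x)
  rw [PeriodicCouple.tangent, hc]
  rw [hc] at horth
  rw [normalVelocity, scaledTangent, hD]
  rw [← h2] at horth hsq ⊢
  generalize fderiv ℝ γ (0, x) (1, 0) = u at *
  generalize fderiv ℝ γ (0, x) (0, 1) = w at *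
  generalize hm : inner ℝ u w = m at *
  rw [inner_add_left, inner_smul_left, hm, real_inner_self_eq_norm_sq, conj_trivial] at horth
  obtain rfl : m = -s * ‖w‖ ^ 2 := by linarith
  have hr : ‖w‖ ^ 2 ≠ 0 := by positivity
  rw [mul_div_assoc, div_self hr, mul_one]
  refine ⟨by rw [neg_smul, sub_neg_eq_add], ?_⟩
  have hv : ‖u + s • w‖ ^ 2 = ‖u‖ ^ 2 - s ^ 2 * ‖w‖ ^ 2 := by
    rw [norm_add_sq_real, inner_smul_right, hm, norm_smul, Real.norm_eq_abs, mul_pow, sq_abs]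
    ring
  rw [hv]
  rw [hv] at hsq
  rw [show -((-1 + ‖u‖ ^ 2) * ‖w‖ ^ 2 - (-s * ‖w‖ ^ 2) ^ 2) =
    (1 - (‖u‖ ^ 2 - s ^ 2 * ‖w‖ ^ 2)) * ‖w‖ ^ 2 by ring, Real.sqrt_mul hsq.le,
    Real.sqrt_sq hgx.le]
  congr 1
  field_simp

/-- The null directions of an extendable couple never meet. In isothermal coordinates the surface
is a superposition of two waves, and every pair of values of the two null fields is attained
at a common point, where their difference is a multiple of the tangent to the curve. -/
theorem PeriodicCouple.Extendable.nullPlus_ne_nullMinus {c : PeriodicCouple n} (h : c.Extendable)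
    (x y : ℝ) : c.nullPlus x ≠ c.nullMinus y := by
  obtain ⟨γ, hcyl, h0, htan⟩ := h
  obtain ⟨X, hsurj, hplus, hminus⟩ := hcyl.exists_null_coordinates
  obtain ⟨hγ, -, ht, -⟩ := hcyl
  set t := (X (0, x) - X (0, y)) / 2 with ht'
  obtain ⟨ξ, hξ⟩ := hsurj t ((X (0, x) + X (0, y)) / 2)
  dsimp only at hξ
  obtain ⟨e1, e2⟩ := normalVelocity_eq hγ ht h0 (htan x)
  obtain ⟨e3, e4⟩ := normalVelocity_eq hγ ht h0 (htan y)
  have h1 := hplus (t, ξ) (0, x) (by rw [hξ, ht']; ring)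
  have h2 := hminus (t, ξ) (0, y) (by rw [hξ, ht']; ring)
  rw [e1, e2] at h1
  rw [e3, e4] at h2
  intro heq
  rw [nullPlus, nullMinus, ← h1, ← h2] at heq
  have h3 : (2 : ℝ) • scaledTangent γ (t, ξ) = 0 := by
    rw [two_smul]
    have := sub_eq_zero.2 heq
    rw [← this]; abel
  have hgx := norm_partial_pos hγ ht (t, ξ)
  have hD := Real.sqrt_pos.2 (neg_pos.2 (ht (t, ξ)))
  rw [scaledTangent, smul_smul, smul_eq_zero] at h3
  rcases h3 with h3 | h3
  · exact absurd h3 (by positivity)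
  · exact absurd h3 (norm_pos_iff.1 hgx)

/-! ### Existence of extremal cylinders -/

theorem eq_of_hasDerivAt_eq {E : Type*} [NormedAddCommGroup E] [NormedSpace ℝ E] {f g f' : ℝ → E}
    (hf : ∀ x, HasDerivAt f (f' x) x) (hg : ∀ x, HasDerivAt g (f' x) x) (h0 : f 0 = g 0) :
    f = g := by
  funext x
  have hd : ∀ x, HasDerivAt (f - g) 0 x := fun x => by simpa using (hf x).sub (hg x)
  have := is_const_of_deriv_eq_zero (fun t => (hd t).differentiableAt) (fun t => (hd t).deriv) x 0
  simpa [h0, sub_eq_zero] using this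

theorem contDiff_one_of_partials {E : Type*} [NormedAddCommGroup E] [NormedSpace ℝ E]
    {f a b : ℝ × ℝ → E} (ha : Continuous a) (hb : Continuous b)
    (h : ∀ z, HasFDerivAt f (ofPartials (a z) (b z)) z) : ContDiff ℝ 1 f :=
  contDiff_one_iff_hasFDerivAt.2 ⟨_, continuous_ofPartials ha hb, h⟩

/-- A superposition `(A(λ + t) ± B(λ - t)) / 2` of two waves is differentiable. -/
theorem hasFDerivAt_waves {E : Type*} [NormedAddCommGroup E] [NormedSpace ℝ E]
    {A B P Q : ℝ → E} {l l' : ℝ → ℝ} (hA : ∀ s, HasDerivAt A (P s) s)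
    (hB : ∀ s, HasDerivAt B (Q s) s) (hl : ∀ x, HasDerivAt l (l' x) x) (hl' : Continuous l')
    (hP : Continuous P) (hQ : Continuous Q) (σ : ℝ) (z : ℝ × ℝ) :
    HasFDerivAt (fun z : ℝ × ℝ => (2 : ℝ)⁻¹ • (A (l z.2 + z.1) + σ • B (l z.2 - z.1)))
      (ofPartials ((2 : ℝ)⁻¹ • (P (l z.2 + z.1) - σ • Q (l z.2 - z.1)))
        ((l' z.2 / 2) • (P (l z.2 + z.1) + σ • Q (l z.2 - z.1)))) z := by
  have hlc : Continuous l := continuous_iff_continuousAt.2 fun x => (hl x).continuousAt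
  refine (hasStrictFDerivAt_of_partials
    (a := fun z => (2 : ℝ)⁻¹ • (P (l z.2 + z.1) - σ • Q (l z.2 - z.1)))
    (b := fun z => (l' z.2 / 2) • (P (l z.2 + z.1) + σ • Q (l z.2 - z.1)))
    (by fun_prop) (by fun_prop) (fun t x => ?_) (fun t x => ?_) z).hasFDerivAt
  · have h1 : HasDerivAt (fun t => A (l x + t)) (P (l x + t)) t := (hA _).comp_const_add _ _
    have h2 : HasDerivAt (fun t => B (l x - t)) (-Q (l x - t)) t := (hB _).comp_const_sub _ _
    convert! (h1.add (h2.const_smul σ)).const_smul (2 : ℝ)⁻¹ using 1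
    simp [sub_eq_add_neg]
  · have h1 : HasDerivAt (fun x => A (l x + t)) (l' x • P (l x + t)) x :=
      (hA _).scomp x ((hl x).add_const t)
    have h2 : HasDerivAt (fun x => B (l x - t)) (l' x • Q (l x - t)) x :=
      (hB _).scomp x ((hl x).sub_const t)
    convert! (h1.add (h2.const_smul σ)).const_smul (2 : ℝ)⁻¹ using 1
    module

/-- The metric coefficients of a surface in terms of its two null velocities `p ≠ q`. -/
theorem metric_of_unit_vectors {p q : Space n} (hp : ‖p‖ = 1) (hq : ‖q‖ = 1) (hpq : p ≠ q) :
    ∃ k : ℝ, k < 1 ∧ ‖(2 : ℝ)⁻¹ • (p + q)‖ ^ 2 = (1 + k) / 2 ∧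
      (∀ l : ℝ, ‖(l / 2) • (p - q)‖ ^ 2 = l ^ 2 * ((1 - k) / 2)) ∧
      ∀ l : ℝ, inner ℝ ((2 : ℝ)⁻¹ • (p + q)) ((l / 2) • (p - q)) = 0 := by
  refine ⟨inner ℝ p q, ?_, ?_, fun l => ?_, fun l => ?_⟩
  · exact inner_lt_one_iff_real_of_norm_eq_one hp hq |>.2 hpq
  · rw [norm_smul, mul_pow, norm_add_sq_real, hp, hq]; norm_num; ring
  · rw [norm_smul, mul_pow, norm_sub_sq_real, hp, hq, Real.norm_eq_abs, sq_abs]; ring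
  · rw [inner_smul_left, inner_smul_right, inner_add_left, inner_sub_right, inner_sub_right,
      real_inner_self_eq_norm_sq, real_inner_self_eq_norm_sq, hp, hq, real_inner_comm]
    simp

/-- A couple whose null directions never meet is extendable: in the energy parametrization,
the superposition of the waves with velocities the two null directions is an extremal cylinder. -/
theorem PeriodicCouple.extendable_of_nullPlus_ne_nullMinus (c : PeriodicCouple n)
    (h : ∀ x y, c.nullPlus x ≠ c.nullMinus y) : c.Extendable := by
  obtain ⟨L, hL, hcL, hvL⟩ := c.periodic
  have hec := c.continuous_energyDensity
  -- the energy parametrization and its inverse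
  set l : ℝ → ℝ := fun x => ∫ y in (0 : ℝ)..x, c.energyDensity y with hl
  have hld : ∀ x, HasDerivAt l (c.energyDensity x) x := fun x =>
    (hec.integral_hasStrictDerivAt 0 x).hasDerivAt
  have hl0 : l 0 = 0 := by simp [hl]
  have hlc : Continuous l := continuous_iff_continuousAt.2 fun x => (hld x).continuousAt
  have hlm : StrictMono l := strictMono_of_hasDerivAt_pos hld c.energyDensity_pos
  have hlL : ∀ x, l (x + L) = l x + l L := fun x => by
    have := congrFun (eq_of_hasDerivAt_eq (f := fun x => l (x + L)) (g := fun x => l x + l L)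
      (f' := c.energyDensity)
      (fun x => by
        have := (hld (x + L)).comp_add_const x L
        rwa [periodic_energyDensity hcL hvL x] at this)
      (fun x => (hld x).add_const _) (by simp [hl0])) x
    exact this
  have hlpos : 0 < l L := hl0 ▸ hlm hL
  let m : ℝ ≃ₜ ℝ := (hlm.orderIsoOfSurjective l (surjective_of_map_add hlc hlpos hlL)).toHomeomorph
  have hml : ∀ x, m.symm (l x) = x := fun x => m.symm_apply_apply x
  have hlm' : ∀ s, l (m.symm s) = s := fun s => m.apply_symm_apply s
  have hmL : ∀ s, m.symm (s + l L) = m.symm s + L := fun s => by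
    rw [← hml (m.symm s + L), hlL, hlm']
  set P : ℝ → Space n := fun s => c.nullPlus (m.symm s) with hP
  set Q : ℝ → Space n := fun s => c.nullMinus (m.symm s) with hQ
  have hPc : Continuous P := c.continuous_nullPlus.comp m.symm.continuous
  have hQc : Continuous Q := c.continuous_nullMinus.comp m.symm.continuous
  have hPL : ∀ s, P (s + l L) = P s := fun s => by
    simp only [hP, hmL, periodic_nullPlus hcL hvL (m.symm s)]
  have hQL : ∀ s, Q (s + l L) = Q s := fun s => by
    simp only [hQ, hmL, periodic_nullMinus hcL hvL (m.symm s)]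
  set A : ℝ → Space n := fun s => ∫ r in (0 : ℝ)..s, P r with hA
  set B : ℝ → Space n := fun s => ∫ r in (0 : ℝ)..s, Q r with hB
  have hAd : ∀ s, HasDerivAt A (P s) s := fun s => (hPc.integral_hasStrictDerivAt 0 s).hasDerivAt
  have hBd : ∀ s, HasDerivAt B (Q s) s := fun s => (hQc.integral_hasStrictDerivAt 0 s).hasDerivAt
  set γ : ℝ × ℝ → Space n := fun z =>
    c.curve 0 + (2 : ℝ)⁻¹ • (A (l z.2 + z.1) + (-1 : ℝ) • B (l z.2 - z.1)) with hγ
  set γt : ℝ × ℝ → Space n := fun z => (2 : ℝ)⁻¹ • (P (l z.2 + z.1) + Q (l z.2 - z.1)) with hγt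
  set γx : ℝ × ℝ → Space n := fun z =>
    (c.energyDensity z.2 / 2) • (P (l z.2 + z.1) - Q (l z.2 - z.1)) with hγx
  have hγd : ∀ z, HasFDerivAt γ (ofPartials (γt z) (γx z)) z := fun z => by
    have := (hasFDerivAt_waves hAd hBd hld hec hPc hQc (-1) z).const_add (c.curve 0)
    simp only [neg_one_smul, sub_neg_eq_add, ← sub_eq_add_neg] at this
    simpa only [hγ, hγt, hγx, neg_one_smul, ← sub_eq_add_neg] using this
  have hγtc : Continuous γt := by fun_prop
  have hγxc : Continuous γx := by fun_prop
  have hγ1 : ContDiff ℝ 1 γ := contDiff_one_of_partials hγtc hγxc hγd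
  have hft : ∀ z, fderiv ℝ γ z (1, 0) = γt z := fun z => by rw [(hγd z).fderiv]; simp
  have hfx : ∀ z, fderiv ℝ γ z (0, 1) = γx z := fun z => by rw [(hγd z).fderiv]; simp
  have hγ0 : ∀ x, γ (0, x) = c.curve x := by
    refine congrFun (eq_of_hasDerivAt_eq (f := fun x => γ (0, x)) (fun x => ?_) c.hasDerivAt_curve ?_)
    · have h1 : HasDerivAt (fun x : ℝ => ((0 : ℝ), x)) ((0 : ℝ), (1 : ℝ)) x :=
        (hasDerivAt_const x 0).prodMk (hasDerivAt_id x)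
      refine ((hγd (0, x)).comp_hasDerivAt x h1).congr_deriv ?_
      simp only [hγx, hP, hQ, add_zero, sub_zero, hml, ofPartials_apply, zero_smul, zero_add,
        c.nullPlus_sub_nullMinus, c.deriv_curve_eq, smul_smul]
      congr 1; ring
    · simp [hγ, hl0, hA, hB]
  have hγper : ∀ t x : ℝ, γ (t, x + L) = γ (t, x) := fun t x => by
    have hd : ∀ x t, HasDerivAt (fun t => γ (t, x)) (γt (t, x)) t := fun x t => by
      have h1 : HasDerivAt (fun t : ℝ => (t, x)) ((1 : ℝ), (0 : ℝ)) t :=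
        (hasDerivAt_id t).prodMk (hasDerivAt_const t x)
      have h2 := HasFDerivAt.comp_hasDerivAt (l := γ) t (hγd (t, x)) h1
      simp only [ofPartials_apply, one_smul, zero_smul, add_zero] at h2
      exact h2
    refine congrFun (eq_of_hasDerivAt_eq (f := fun t => γ (t, x + L)) (g := fun t => γ (t, x))
      (fun t => ?_) (hd x) (by simp only [hγ0, hcL x])) t
    have : γt (t, x + L) = γt (t, x) := by
      simp only [hγt, hlL]
      rw [show l x + l L + t = l x + t + l L by ring, show l x + l L - t = l x - t + l L by ring,
        hPL, hQL]
    exact this ▸ hd (x + L) t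
  have hmetric := fun z : ℝ × ℝ => metric_of_unit_vectors (c.norm_nullPlus (m.symm (l z.2 + z.1)))
    (c.norm_nullMinus (m.symm (l z.2 - z.1))) (h _ _)
  have hdet : ∀ z, ∃ k : ℝ, k < 1 ∧ ‖γt z‖ ^ 2 = (1 + k) / 2 ∧
      ‖γx z‖ ^ 2 = c.energyDensity z.2 ^ 2 * ((1 - k) / 2) ∧ inner ℝ (γt z) (γx z) = 0 ∧
      metricDet (graphMap γ) z = -(c.energyDensity z.2 * ((1 - k) / 2)) ^ 2 := fun z => by
    obtain ⟨k, hk, h1, h2, h3⟩ := hmetric z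
    replace h1 : ‖γt z‖ ^ 2 = _ := h1
    replace h2 : ‖γx z‖ ^ 2 = _ := h2 (c.energyDensity z.2)
    replace h3 : inner ℝ (γt z) (γx z) = 0 := h3 (c.energyDensity z.2)
    refine ⟨k, hk, h1, h2, h3, ?_⟩
    rw [metricDet_graphMap hγ1, hft, hfx, h1, h2, h3]
    ring
  have htime : IsTimelike (graphMap γ) := fun z => by
    obtain ⟨k, hk, -, -, -, h4⟩ := hdet z
    rw [h4, neg_lt_zero]
    have := c.energyDensity_pos z.2
    have : 0 < (1 - k) / 2 := by linarith
    positivity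
  have hflux : ∀ z, fluxT (graphMap γ) z = (c.energyDensity z.2, c.energyDensity z.2 • γt z) ∧
      fluxX (graphMap γ) z =
        (0, -((2 : ℝ)⁻¹ • (P (l z.2 + z.1) - Q (l z.2 - z.1)))) := fun z => by
    obtain ⟨k, hk, h1, h2, h3, h4⟩ := hdet z
    have he := c.energyDensity_pos z.2
    have hk' : 0 < 1 - k := by linarith
    rw [fluxT_graphMap hγ1, fluxX_graphMap hγ1, hft, hfx, h1, h2, h3, h4, neg_neg,
      Real.sqrt_sq (by positivity)]
    refine ⟨Prod.ext ?_ ?_, Prod.ext ?_ ?_⟩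
    · simp; field_simp
    · simp only [zero_smul, sub_zero, Prod.smul_mk, smul_smul]
      congr 1; field_simp
    · simp
    · simp only [zero_smul, sub_zero, Prod.smul_mk, smul_smul, hγx, ← neg_smul]
      congr 1; field_simp; ring
  have hext : IsExtremal (graphMap γ) := by
    refine isExtremal_of_isWeaklyDivFree (contDiff_graphMap hγ1) htime ?_ fun i => ?_
    · simp only [hflux]
      refine isWeaklyDivFree_of_potential (W := fun z => l z.2) (by fun_prop) continuous_const
        fun z => ?_
      have := (hld z.2).hasFDerivAt.comp z hasFDerivAt_snd
      convert! this using 1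
      ext <;> simp
    · simp only [hflux]
      have hi : Continuous fun v : Space n => v i := (EuclideanSpace.proj (𝕜 := ℝ) i).continuous
      refine isWeaklyDivFree_of_potential (W := fun z =>
        ((2 : ℝ)⁻¹ • (A (l z.2 + z.1) + (1 : ℝ) • B (l z.2 - z.1))) i)
        (hi.comp (by fun_prop)) (hi.comp (by fun_prop)) fun z => ?_
      have := (EuclideanSpace.proj (𝕜 := ℝ) i).hasFDerivAt.comp z
        (hasFDerivAt_waves hAd hBd hld hec hPc hQc 1 z)
      convert! this using 1
      ext
      · simp
      · simp [hγt]; ring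
  refine ⟨γ, ⟨hγ1, ⟨L, hL, hγper⟩, htime, hext⟩, hγ0, fun x => ⟨(1, 0), ?_⟩⟩
  change partialT (graphMap γ) (0, x) = _
  rw [partialT_graphMap hγ1, hft]
  simp only [hγt, hP, hQ, add_zero, sub_zero, hml, c.nullPlus_add_nullMinus, smul_smul]
  norm_num

theorem PeriodicCouple.extendable_iff (c : PeriodicCouple n) :
    c.Extendable ↔ ∀ x y, c.nullPlus x ≠ c.nullMinus y :=
  ⟨fun h => h.nullPlus_ne_nullMinus, c.extendable_of_nullPlus_ne_nullMinus⟩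

/-! ### The topologies on couples -/

namespace PeriodicCouple

/-- The couples `c` and `d` are `ε`-close in the `C¹ × C⁰` distance. -/
def Near (ε : ℝ) (c d : PeriodicCouple n) : Prop :=
  ∀ x, ‖d.curve x - c.curve x‖ < ε ∧ ‖deriv d.curve x - deriv c.curve x‖ < ε ∧
    ‖d.velocity x - c.velocity x‖ < ε

theorem mem_nhds_uniformTopology {c : PeriodicCouple n} {s : Set (PeriodicCouple n)} :
    s ∈ @nhds _ (uniformTopology n) c ↔ ∃ ε > 0, ∀ d, Near ε c d → d ∈ s := by
  have hb : ∀ f : ℝ → Space n, (𝓝 (UniformFun.ofFun f)).HasBasis (fun ε : ℝ => 0 < ε)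
      fun ε => {g | ∀ x, ‖UniformFun.toFun g x - f x‖ < ε} := fun f => by
    have := UniformFun.hasBasis_nhds_of_basis ℝ (Space n) (UniformFun.ofFun f)
      Metric.uniformity_basis_dist
    refine this.congr (fun _ => Iff.rfl) fun ε _ => ?_
    ext g
    refine forall_congr' fun x => ?_
    change dist (f x) (UniformFun.toFun g x) < ε ↔ _
    rw [dist_comm, dist_eq_norm]
  rw [nhds_induced, nhds_prod_eq, nhds_prod_eq]
  rw [(((hb c.curve).prod ((hb (deriv c.curve)).prod (hb c.velocity))).comap _).mem_iff]
  constructor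
  · rintro ⟨⟨ε₁, ε₂, ε₃⟩, ⟨h1, h2, h3⟩, hs⟩
    dsimp only at h1 h2 h3
    refine ⟨min ε₁ (min ε₂ ε₃), by positivity, fun d hd => hs ⟨fun x => ?_, fun x => ?_, fun x => ?_⟩⟩
    · exact (hd x).1.trans_le (min_le_left _ _)
    · exact (hd x).2.1.trans_le ((min_le_right _ _).trans (min_le_left _ _))
    · exact (hd x).2.2.trans_le ((min_le_right _ _).trans (min_le_right _ _))
  · rintro ⟨ε, hε, hs⟩
    exact ⟨⟨ε, ε, ε⟩, ⟨hε, hε, hε⟩, fun d hd => hs d fun x => ⟨hd.1 x, hd.2.1 x, hd.2.2 x⟩⟩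

theorem isOpen_xTopology_iff {s : Set (PeriodicCouple n)} :
    IsOpen s ↔ ∃ t, IsOpen[uniformTopology n] (Quotient.mk (equivSetoid n) ⁻¹' t) ∧
      Quotient.mk (equivSetoid n) ⁻¹' t = s :=
  Iff.rfl

theorem isOpen_of_invariant {s : Set (PeriodicCouple n)}
    (hinv : ∀ c d, Equivalent c d → c ∈ s → d ∈ s) (hs : ∀ c ∈ s, ∃ ε > 0, ∀ d, Near ε c d → d ∈ s) :
    IsOpen s := by
  have hpre : Quotient.mk (equivSetoid n) ⁻¹' (Quotient.mk (equivSetoid n) '' s) = s := by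
    refine Subset.antisymm ?_ (subset_preimage_image _ _)
    rintro d ⟨c, hc, hcd⟩
    exact hinv c d (Quotient.exact hcd) hc
  refine isOpen_xTopology_iff.2 ⟨_, ?_, hpre⟩
  rw [hpre]
  have h : ∀ c ∈ s, s ∈ @nhds _ (uniformTopology n) c := fun c hc =>
    mem_nhds_uniformTopology.2 (hs c hc)
  let := uniformTopology n
  exact isOpen_iff_mem_nhds.2 h

theorem exists_near_subset {s : Set (PeriodicCouple n)} (hs : IsOpen s) {c : PeriodicCouple n}
    (hc : c ∈ s) : ∃ ε > 0, ∀ d, Near ε c d → d ∈ s := by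
  obtain ⟨t, ht, rfl⟩ := isOpen_xTopology_iff.1 hs
  refine mem_nhds_uniformTopology.1 ?_
  let := uniformTopology n
  exact ht.mem_nhds hc

/-- A change of parameter preserves the two null directions, and exchanges them if it reverses the
orientation. -/
theorem Equivalent.null_eq {c d : PeriodicCouple n} (h : Equivalent c d) :
    ∃ l : ℝ ≃ ℝ, Continuous l.symm ∧
      ((c.nullPlus = d.nullPlus ∘ l ∧ c.nullMinus = d.nullMinus ∘ l) ∨
        (c.nullPlus = d.nullMinus ∘ l ∧ c.nullMinus = d.nullPlus ∘ l)) := by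
  obtain ⟨l, hl, hl', hc, hv⟩ := h
  refine ⟨l, hl'.continuous, ?_⟩
  have hd : ∀ x, deriv c.curve x = deriv l x • deriv d.curve (l x) := fun x => by
    rw [hc]
    exact ((d.hasDerivAt_curve (l x)).scomp x (hl.differentiable one_ne_zero x).hasDerivAt).deriv
  have hne : ∀ x, deriv l x ≠ 0 := fun x h0 => c.immersion x (by rw [hd, h0, zero_smul])
  have htan : ∀ x, c.tangent x = (SignType.sign (deriv l x) : ℝ) • d.tangent (l x) := fun x => by
    have hvx : c.velocity x = d.velocity (l x) := congrFun hv x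
    have h1 := abs_pos.2 (hne x)
    rw [tangent, tangent, hd, hvx, norm_smul, Real.norm_eq_abs, smul_smul, smul_smul]
    congr 1
    have h2 := sign_mul_abs (deriv l x)
    have h3 := norm_pos_iff.2 (d.immersion (l x))
    nth_rewrite 2 [← h2]
    field_simp
  have hcont : Continuous (deriv l) := hl.continuous_deriv le_rfl
  have hsign : (∀ x, 0 < deriv l x) ∨ ∀ x, deriv l x < 0 := by
    by_contra! hcon
    obtain ⟨⟨x, hx⟩, y, hy⟩ := hcon
    obtain ⟨z, hz⟩ := mem_range_of_exists_le_of_exists_ge hcont ⟨x, hx⟩ ⟨y, hy⟩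
    exact hne z hz
  rcases hsign with hs | hs
  · left
    constructor <;> funext x <;>
      simp [nullPlus, nullMinus, htan, sign_pos (hs x), congrFun hv x]
  · right
    constructor <;> funext x <;>
      simp [nullPlus, nullMinus, htan, sign_neg (hs x), congrFun hv x, sub_eq_add_neg]

theorem Equivalent.extendable {c d : PeriodicCouple n} (h : Equivalent c d) (hc : c.Extendable) :
    d.Extendable := by
  rw [extendable_iff] at hc ⊢
  obtain ⟨l, -, h⟩ := h.null_eq
  intro x y hxy
  rcases h with ⟨h1, h2⟩ | ⟨h1, h2⟩
  · exact hc (l.symm x) (l.symm y) (by simpa [h1, h2] using hxy)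
  · exact hc (l.symm y) (l.symm x) (by simpa [h1, h2] using hxy.symm)

/-- The null directions depend continuously on the couple. -/
theorem exists_near_null (c : PeriodicCouple n) {ε : ℝ} (hε : 0 < ε) :
    ∃ δ > 0, ∀ d, Near δ c d → ∀ x, ‖d.nullPlus x - c.nullPlus x‖ < ε ∧
      ‖d.nullMinus x - c.nullMinus x‖ < ε := by
  obtain ⟨L, hL, hcL, hvL⟩ := c.periodic
  set K := range fun x => (deriv c.curve x, c.velocity x) with hK
  have hKc : IsCompact K := Function.Periodic.compact_of_continuous (c := L)
    (fun x => Prod.ext (c.periodic_deriv hcL x) (hvL x)) hL.ne'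
    (c.continuous_deriv_curve.prodMk c.continuous_velocity)
  let F : ℝ → Space n × Space n → Space n := fun σ w =>
    w.2 + σ • ((Real.sqrt (1 - ‖w.2‖ ^ 2) * ‖w.1‖⁻¹) • w.1)
  have hF : ∀ σ, ∀ w ∈ K, ContinuousAt (F σ) w := by
    rintro σ _ ⟨x, rfl⟩
    have h1 : ContinuousAt (fun w : Space n × Space n => ‖w.1‖⁻¹)
        (deriv c.curve x, c.velocity x) :=
      continuousAt_fst.norm.inv₀ (norm_ne_zero_iff.2 (c.immersion x))
    have h2 : ContinuousAt (fun w : Space n × Space n => Real.sqrt (1 - ‖w.2‖ ^ 2))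
        (deriv c.curve x, c.velocity x) := by fun_prop
    exact continuousAt_snd.add (((h2.mul h1).smul continuousAt_fst).const_smul σ)
  have key : ∀ σ, ∃ δ > 0, ∀ w ∈ K, ∀ w', dist w w' < δ → dist (F σ w) (F σ w') < ε := fun σ => by
    obtain ⟨δ, hδ, h⟩ := Metric.mem_uniformity_dist.1
      (hKc.uniformContinuousAt_of_continuousAt (F σ) (hF σ) (Metric.dist_mem_uniformity hε))
    exact ⟨δ, hδ, fun w hw w' hww' => h hww' hw⟩
  obtain ⟨δ₁, hδ₁, h₁⟩ := key 1
  obtain ⟨δ₂, hδ₂, h₂⟩ := key (-1)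
  refine ⟨min δ₁ δ₂, by positivity, fun d hd x => ?_⟩
  have hdist : dist (deriv c.curve x, c.velocity x) (deriv d.curve x, d.velocity x) <
      min δ₁ δ₂ := by
    rw [dist_comm, Prod.dist_eq, dist_eq_norm, dist_eq_norm]
    exact max_lt (hd x).2.1 (hd x).2.2
  have e1 := h₁ _ ⟨x, rfl⟩ _ (hdist.trans_le (min_le_left _ _))
  have e2 := h₂ _ ⟨x, rfl⟩ _ (hdist.trans_le (min_le_right _ _))
  rw [dist_comm, dist_eq_norm] at e1 e2
  constructor
  · simp only [F, one_smul] at e1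
    exact e1
  · simp only [F, neg_one_smul, ← sub_eq_add_neg] at e2
    exact e2

theorem isOpen_extendable : IsOpen {c : PeriodicCouple n | c.Extendable} := by
  refine isOpen_of_invariant (fun c d h hc => h.extendable hc) fun c hc => ?_
  have hne := c.extendable_iff.1 hc
  obtain ⟨L, hL, hcL, hvL⟩ := c.periodic
  have k1 := (periodic_nullPlus hcL hvL).compact_of_continuous hL.ne' c.continuous_nullPlus
  have k2 := (periodic_nullMinus hcL hvL).compact_of_continuous hL.ne' c.continuous_nullMinus
  obtain ⟨ε, hε, hdisj⟩ := Disjoint.exists_thickenings (s := range c.nullPlus)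
    (t := range c.nullMinus) (by
      rw [Set.disjoint_left]
      rintro _ ⟨x, rfl⟩ ⟨y, hy⟩
      exact hne x y hy.symm) k1 k2.isClosed
  obtain ⟨δ, hδ, h⟩ := c.exists_near_null hε
  refine ⟨δ, hδ, fun d hd => d.extendable_iff.2 fun x y hxy => ?_⟩
  refine Set.disjoint_left.1 hdisj (?_ : d.nullPlus x ∈ _) ?_
  · exact Metric.mem_thickening_iff.2 ⟨_, mem_range_self x, by
      rw [dist_eq_norm]; exact (h d hd x).1⟩
  · rw [hxy]
    exact Metric.mem_thickening_iff.2 ⟨_, mem_range_self y, by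
      rw [dist_eq_norm]; exact (h d hd y).2⟩

/-- The couples whose null directions meet stably form an open set. -/
theorem isOpen_meetStably :
    IsOpen {c : PeriodicCouple n | MeetStably c.nullPlus c.nullMinus} := by
  refine isOpen_of_invariant (fun c d h hc => ?_) fun c hc => ?_
  · obtain ⟨l, hl, h⟩ := (equivalent_equivalence.symm h).null_eq
    rcases h with ⟨h1, h2⟩ | ⟨h1, h2⟩
    · rw [mem_ofPred_eq, h1, h2]; exact hc.comp l hl
    · rw [mem_ofPred_eq, h1, h2]; exact hc.symm.comp l hl
  · obtain ⟨η, hη, hm⟩ := hc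
    obtain ⟨δ, hδ, h⟩ := c.exists_near_null (half_pos hη)
    refine ⟨δ, hδ, fun d hd => ⟨η / 2, half_pos hη, fun P Q hP hQ hP1 hQ1 hPp hQq =>
      hm P Q hP hQ hP1 hQ1 (fun x => ?_) fun x => ?_⟩⟩
    · have := norm_sub_le_norm_sub_add_norm_sub (P x) (d.nullPlus x) (c.nullPlus x)
      linarith [hPp x, (h d hd x).1]
    · have := norm_sub_le_norm_sub_add_norm_sub (Q x) (d.nullMinus x) (c.nullMinus x)
      linarith [hQq x, (h d hd x).2]

theorem not_extendable_of_meetStably {c : PeriodicCouple n}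
    (h : MeetStably c.nullPlus c.nullMinus) : ¬ c.Extendable := by
  obtain ⟨x, y, hxy⟩ := h.exists_eq c.continuous_nullPlus c.continuous_nullMinus c.norm_nullPlus
    c.norm_nullMinus
  exact fun hc => c.extendable_iff.1 hc x y hxy

end PeriodicCouple

/-! ### Perturbation of couples -/

/-- The composite of the map which collapses the `ε`-ball around `e` to the point `e` and moves the
points outside by `ε` towards `e`, the translation by `ε s f` and the radial projection to the unit
sphere. -/
def bend (ε : ℝ) (e f : Space n) (s : ℝ) (u : Space n) : Space n :=
  ‖e + (1 - ε / max ‖u - e‖ ε) • (u - e) + (ε * s) • f‖⁻¹ •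
    (e + (1 - ε / max ‖u - e‖ ε) • (u - e) + (ε * s) • f)

theorem norm_prebend_sub_le {ε : ℝ} (hε : 0 < ε) {e f u : Space n} {s : ℝ} (hf : ‖f‖ = 1)
    (hs : |s| ≤ 1) :
    ‖e + (1 - ε / max ‖u - e‖ ε) • (u - e) + (ε * s) • f - u‖ ≤ 2 * ε := by
  have hm : 0 < max ‖u - e‖ ε := lt_max_of_lt_right hε
  have h1 : e + (1 - ε / max ‖u - e‖ ε) • (u - e) + (ε * s) • f - u =
      (ε * s) • f - (ε / max ‖u - e‖ ε) • (u - e) := by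
    rw [sub_smul, one_smul]; abel
  rw [h1]
  refine (norm_sub_le _ _).trans ?_
  rw [norm_smul, norm_smul, hf, Real.norm_eq_abs, Real.norm_eq_abs, abs_mul, abs_of_pos hε,
    abs_of_pos (div_pos hε hm)]
  have h2 : ε / max ‖u - e‖ ε * ‖u - e‖ ≤ ε := by
    rw [div_mul_eq_mul_div, div_le_iff₀ hm]
    exact mul_le_mul_of_nonneg_left (le_max_left _ _) hε.le
  nlinarith

theorem norm_prebend_pos {ε : ℝ} (hε : 0 < ε) (hε' : ε < 1 / 4) {e f u : Space n} {s : ℝ}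
    (hf : ‖f‖ = 1) (hs : |s| ≤ 1) (hu : ‖u‖ = 1) :
    0 < ‖e + (1 - ε / max ‖u - e‖ ε) • (u - e) + (ε * s) • f‖ := by
  have h1 := norm_prebend_sub_le (e := e) (u := u) hε hf hs
  have h2 := norm_sub_norm_le u (e + (1 - ε / max ‖u - e‖ ε) • (u - e) + (ε * s) • f)
  rw [norm_sub_rev u (_ + _), hu] at h2
  linarith

theorem norm_bend {ε : ℝ} (hε : 0 < ε) (hε' : ε < 1 / 4) {e f u : Space n} {s : ℝ}
    (hf : ‖f‖ = 1) (hs : |s| ≤ 1) (hu : ‖u‖ = 1) : ‖bend ε e f s u‖ = 1 := by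
  have h := norm_prebend_pos (e := e) hε hε' hf hs hu
  rw [bend, norm_smul, norm_inv, norm_norm, inv_mul_cancel₀ h.ne']

theorem norm_bend_sub_le {ε : ℝ} (hε : 0 < ε) (hε' : ε < 1 / 4) {e f u : Space n} {s : ℝ}
    (hf : ‖f‖ = 1) (hs : |s| ≤ 1) (hu : ‖u‖ = 1) : ‖bend ε e f s u - u‖ ≤ 4 * ε := by
  have h0 := norm_prebend_pos (e := e) hε hε' hf hs hu
  have h1 := norm_prebend_sub_le (e := e) (u := u) hε hf hs
  rw [bend]
  set z := e + (1 - ε / max ‖u - e‖ ε) • (u - e) + (ε * s) • f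
  have h2 : ‖‖z‖⁻¹ • z - z‖ ≤ 2 * ε := by
    have : ‖z‖⁻¹ • z - z = (‖z‖⁻¹ * (1 - ‖z‖)) • z := by
      rw [mul_sub, mul_one, inv_mul_cancel₀ h0.ne', sub_smul, one_smul]
    rw [this, norm_smul, norm_mul, norm_inv, norm_norm, mul_right_comm, inv_mul_cancel₀ h0.ne',
      one_mul, ← hu]
    refine (abs_norm_sub_norm_le u z).trans ?_
    rwa [norm_sub_rev]
  have := norm_sub_le_norm_sub_add_norm_sub (‖z‖⁻¹ • z) z u
  linarith

theorem exists_bend_eq {ε : ℝ} (hε : 0 < ε) (hε' : ε < 1 / 4) {e f u : Space n} {s : ℝ}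
    (he : ‖e‖ = 1) (hf : ‖f‖ = 1) (hs : |s| ≤ 1) (hu : ‖u‖ = 1) (hue : ‖u - e‖ ≤ ε) :
    ∃ N : ℝ, 1 / 2 ≤ N ∧ bend ε e f s u = N • (e + (ε * s) • f) := by
  have h0 := norm_prebend_pos (e := e) hε hε' hf hs hu
  have h1 : e + (1 - ε / max ‖u - e‖ ε) • (u - e) + (ε * s) • f = e + (ε * s) • f := by
    rw [max_eq_right hue, div_self hε.ne']; simp
  rw [bend, h1]
  rw [h1] at h0
  refine ⟨_, ?_, rfl⟩
  have h2 : ‖e + (ε * s) • f‖ ≤ 2 := by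
    refine (norm_add_le _ _).trans ?_
    rw [norm_smul, he, hf, Real.norm_eq_abs, abs_mul, abs_of_pos hε]
    nlinarith
  rw [one_div]
  exact inv_anti₀ h0 h2

theorem continuous_bend {ε : ℝ} (hε : 0 < ε) (hε' : ε < 1 / 4) {e f : Space n} (hf : ‖f‖ = 1)
    {u : ℝ → Space n} {s : ℝ → ℝ} (hu : Continuous u) (hs : Continuous s) (hs1 : ∀ x, |s x| ≤ 1)
    (hu1 : ∀ x, ‖u x‖ = 1) : Continuous fun x => bend ε e f (s x) (u x) := by
  have hm : ∀ x, max ‖u x - e‖ ε ≠ 0 := fun x => (lt_max_of_lt_right hε).ne'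
  have h1 : Continuous fun x =>
      e + (1 - ε / max ‖u x - e‖ ε) • (u x - e) + (ε * s x) • f := by
    have : Continuous fun x => ε / max ‖u x - e‖ ε := continuous_const.div (by fun_prop) hm
    fun_prop
  exact (h1.norm.inv₀ fun x => (norm_prebend_pos hε hε' hf (hs1 x) (hu1 x)).ne').smul h1

namespace PeriodicCouple

/-- A couple with prescribed derivative of the curve, velocity and base point. -/
theorem exists_of_deriv (a : Space n) {g w : ℝ → Space n} {L : ℝ} (hL : 0 < L) (hg : Continuous g)
    (hw : Continuous w) (hgL : Function.Periodic g L) (hwL : Function.Periodic w L)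
    (hg0 : ∀ x, g x ≠ 0) (hwg : ∀ x, inner ℝ (w x) (g x) = 0) (hw1 : ∀ x, ‖w x‖ < 1)
    (hint : ∫ x in (0 : ℝ)..L, g x = 0) :
    ∃ d : PeriodicCouple n, d.curve 0 = a ∧ deriv d.curve = g ∧ d.velocity = w ∧
      Function.Periodic d.curve L := by
  have hd : ∀ x, HasDerivAt (fun x => a + ∫ y in (0 : ℝ)..x, g y) (g x) x := fun x =>
    (hg.integral_hasStrictDerivAt 0 x).hasDerivAt.const_add a
  have hd' : deriv (fun x => a + ∫ y in (0 : ℝ)..x, g y) = g := funext fun x => (hd x).deriv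
  have hper : Function.Periodic (fun x => a + ∫ y in (0 : ℝ)..x, g y) L := fun x => by
    refine congrFun (eq_of_hasDerivAt_eq (f := fun x => a + ∫ y in (0 : ℝ)..(x + L), g y)
      (f' := g) (fun x => ?_) hd ?_) x
    · have := (hd (x + L)).comp_add_const x L
      rwa [hgL x] at this
    · simp [hint]
  refine ⟨{ curve := fun x => a + ∫ y in (0 : ℝ)..x, g y
            velocity := w
            contDiff_curve := contDiff_one_iff_deriv.2
              ⟨fun x => (hd x).differentiableAt, by rwa [hd']⟩
            continuous_velocity := hw
            immersion := by rwa [hd']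
            orthogonal := by rwa [hd']
            subluminal := hw1
            periodic := ⟨L, hL, hper, hwL⟩ }, by simp, hd', rfl, hper⟩

theorem near_of_deriv {c d : PeriodicCouple n} {L ε δ : ℝ} (hL : 0 < L)
    (hc : Function.Periodic c.curve L) (hd : Function.Periodic d.curve L)
    (h0 : d.curve 0 = c.curve 0) (hδ : ∀ x, ‖deriv d.curve x - deriv c.curve x‖ ≤ δ)
    (h1 : δ < ε) (h2 : δ * L < ε) (hv : ∀ x, ‖d.velocity x - c.velocity x‖ < ε) : Near ε c d := by
  intro x
  refine ⟨?_, (hδ x).trans_lt h1, hv x⟩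
  have hper : Function.Periodic (fun x => d.curve x - c.curve x) L := fun x => by
    simp only [hc x, hd x]
  obtain ⟨y, ⟨hy0, hyL⟩, hxy⟩ := hper.exists_mem_Ico₀ hL x
  replace hxy : d.curve x - c.curve x = d.curve y - c.curve y := hxy
  rw [hxy]
  have h3 := convex_univ.norm_image_sub_le_of_norm_hasDerivWithin_le
    (f := fun x => d.curve x - c.curve x) (x := 0) (y := y) (C := δ)
    (fun x _ => ((d.hasDerivAt_curve x).sub (c.hasDerivAt_curve x)).hasDerivWithinAt)
    (fun x _ => hδ x) (mem_univ _) (mem_univ _)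
  rw [h0, sub_self, sub_zero, sub_zero, Real.norm_eq_abs, abs_of_nonneg hy0] at h3
  have hδ0 : 0 ≤ δ := (norm_nonneg _).trans (hδ 0)
  nlinarith

/-- The null directions of a couple given by unit vectors `p ≠ q`. -/
theorem null_eq_of_unit {d : PeriodicCouple n} {x r : ℝ} {p q : Space n} (hp : ‖p‖ = 1)
    (hq : ‖q‖ = 1) (hpq : p ≠ q) (hr : 0 < r) (hd : deriv d.curve x = r • (p - q))
    (hv : d.velocity x = (2 : ℝ)⁻¹ • (p + q)) : d.nullPlus x = p ∧ d.nullMinus x = q := by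
  have hpos : 0 < ‖p - q‖ := norm_pos_iff.2 (sub_ne_zero.2 hpq)
  have h1 : 1 - ‖d.velocity x‖ ^ 2 = (‖p - q‖ / 2) ^ 2 := by
    have := parallelogram_law_with_norm ℝ p q
    rw [hv, norm_smul, mul_pow]
    rw [hp, hq] at this
    norm_num
    linarith
  have h2 : d.tangent x = (2 : ℝ)⁻¹ • (p - q) := by
    rw [tangent, h1, Real.sqrt_sq (by positivity), hd, norm_smul, Real.norm_eq_abs,
      abs_of_pos hr, smul_smul]
    congr 1
    field_simp
  constructor
  · rw [nullPlus, hv, h2]; module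
  · rw [nullMinus, hv, h2]; module

end PeriodicCouple

/-- A nonnegative periodic function with positive mean which vanishes near two given points. It is
positive at their midpoint, which by assumption is not congruent to them modulo the period. -/
theorem exists_periodic_cutoff {L x₀ y₀ : ℝ} (hL : 0 < L)
    (hne : ∀ k : ℤ, y₀ - x₀ ≠ k * (2 * L)) :
    ∃ χ : ℝ → ℝ, Continuous χ ∧ Function.Periodic χ L ∧ (∀ x, 0 ≤ χ x) ∧ (∀ x, χ x ≤ 4) ∧
      (∀ᶠ x in 𝓝 x₀, χ x = 0) ∧ (∀ᶠ x in 𝓝 y₀, χ x = 0) ∧ 0 < ∫ x in (0 : ℝ)..L, χ x := by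
  set ω := 2 * Real.pi / L with hω
  have hωL : ω * L = 2 * Real.pi := by rw [hω]; field_simp
  have hωpos : 0 < ω := by positivity
  set D : ℝ → ℝ := fun x => (1 - Real.cos (ω * (x - x₀))) * (1 - Real.cos (ω * (x - y₀))) with hD
  have hDc : Continuous D := by fun_prop
  set z := (x₀ + y₀) / 2 with hz
  have hcos : ∀ t : ℝ, t = (y₀ - x₀) / 2 ∨ t = -((y₀ - x₀) / 2) → 0 < 1 - Real.cos (ω * t) := by
    intro t ht
    rw [sub_pos]
    refine lt_of_le_of_ne (Real.cos_le_one _) fun h1 => ?_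
    have h2 : Real.cos (ω * ((y₀ - x₀) / 2)) = 1 := by
      rcases ht with rfl | rfl
      · exact h1
      · rwa [mul_neg, Real.cos_neg] at h1
    obtain ⟨k, hk⟩ := (Real.cos_eq_one_iff _).1 h2
    refine hne k (mul_left_cancel₀ hωpos.ne' ?_)
    have : ω * (k * (2 * L)) = k * (2 * (ω * L)) := by ring
    rw [this, hωL]
    linarith
  have hDz : 0 < D z := by
    refine mul_pos (hcos _ (Or.inl ?_)) (hcos _ (Or.inr ?_)) <;> rw [hz] <;> ring
  have hD4 : ∀ x, D x ≤ 4 := fun x => by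
    have h1 := Real.neg_one_le_cos (ω * (x - x₀))
    have h2 := Real.neg_one_le_cos (ω * (x - y₀))
    have h3 := Real.cos_le_one (ω * (x - x₀))
    have h4 := Real.cos_le_one (ω * (x - y₀))
    simp only [hD]
    nlinarith
  have hper : Function.Periodic D L := fun x => by
    simp only [hD]
    rw [show ω * (x + L - x₀) = ω * (x - x₀) + ω * L by ring,
      show ω * (x + L - y₀) = ω * (x - y₀) + ω * L by ring, hωL, Real.cos_add_two_pi,
      Real.cos_add_two_pi]
  have hzero : ∀ x, D x = 0 → ∀ᶠ y in 𝓝 x, max 0 (D y - D z / 2) = 0 := fun x hx => by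
    have : ∀ᶠ y in 𝓝 x, D y < D z / 2 :=
      hDc.continuousAt.eventually_lt continuousAt_const (by rw [hx]; positivity)
    filter_upwards [this] with y hy
    exact max_eq_left (by linarith)
  have hχper : Function.Periodic (fun x => max 0 (D x - D z / 2)) L := fun x => by
    simp only [hper x]
  refine ⟨fun x => max 0 (D x - D z / 2), by fun_prop, hχper, fun x => le_max_left _ _,
    fun x => max_le (by norm_num) (by linarith [hD4 x]), hzero _ (by simp [hD]),
    hzero _ (by simp [hD]), ?_⟩
  have := hχper.intervalIntegral_add_eq 0 z
  rw [zero_add] at this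
  rw [this]
  exact intervalIntegral.integral_pos (by linarith) (by fun_prop) (fun x _ => le_max_left _ _)
    ⟨z, ⟨le_rfl, by linarith⟩, lt_max_of_lt_right (by linarith)⟩

theorem exists_orthonormal_frame {e : Space 3} (he : ‖e‖ = 1) :
    ∃ f₁ f₂ : Space 3, Orthonormal ℝ ![e, f₁, f₂] := by
  have hv : Orthonormal ℝ (({0} : Set (Fin 3)).domRestrict fun _ : Fin 3 => e) := by
    refine ⟨fun _ => he, fun i j hij => absurd (Subsingleton.elim i j) hij⟩
  obtain ⟨b, hb⟩ := hv.exists_orthonormalBasis_extension_of_card_eq (by simp)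
  refine ⟨b 1, b 2, ?_⟩
  have h0 : b 0 = e := hb 0 rfl
  have : ![e, b 1, b 2] = b := by
    funext i
    fin_cases i <;> simp [h0]
  rw [this]
  exact b.orthonormal

theorem eventually_mul_lt (K : ℝ) {η : ℝ} (hη : 0 < η) : ∀ᶠ ε in 𝓝[>] (0 : ℝ), K * ε < η := by
  have : ContinuousAt (fun ε : ℝ => K * ε) 0 := by fun_prop
  exact (this.eventually_lt continuousAt_const (by simpa using hη)).filter_mono
    nhdsWithin_le_nhds

namespace PeriodicCouple

theorem exists_pos_le_of_periodic {f : ℝ → ℝ} {L : ℝ} (hL : 0 < L) (hf : Continuous f)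
    (hper : Function.Periodic f L) (hpos : ∀ x, 0 < f x) :
    ∃ m M : ℝ, 0 < m ∧ 0 < M ∧ ∀ x, m ≤ f x ∧ f x ≤ M := by
  have hK := hper.compact_of_continuous hL.ne' hf
  obtain ⟨_, ⟨a, rfl⟩, ha⟩ := hK.exists_isLeast (range_nonempty f)
  obtain ⟨_, ⟨b, rfl⟩, hb⟩ := hK.exists_isGreatest (range_nonempty f)
  exact ⟨f a, f b, hpos a, hpos b, fun x => ⟨ha ⟨x, rfl⟩, hb ⟨x, rfl⟩⟩⟩

/-- The null directions of a couple can be prescribed, up to a small error, wherever a given cutoff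
`χ` vanishes. The new null directions change `γ₀'`, and the integral of `γ₀'` over a period is
restored by a further small change where `χ` does not vanish. -/
theorem exists_near_of_null (c : PeriodicCouple n) {L : ℝ} (hL : 0 < L)
    (hcL : Function.Periodic c.curve L) (hvL : Function.Periodic c.velocity L) {χ : ℝ → ℝ}
    (hχc : Continuous χ) (hχL : Function.Periodic χ L) (hχ0 : ∀ x, 0 ≤ χ x) (hχ4 : ∀ x, χ x ≤ 4)
    (hχI : 0 < ∫ x in (0 : ℝ)..L, χ x) {ε : ℝ} (hε : 0 < ε) :
    ∃ η₀ > 0, ∀ p q : ℝ → Space n, Continuous p → Continuous q → Function.Periodic p L →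
      Function.Periodic q L → (∀ x, ‖p x‖ = 1) → (∀ x, ‖q x‖ = 1) →
      (∀ x, ‖p x - c.nullPlus x‖ ≤ η₀) → (∀ x, ‖q x - c.nullMinus x‖ ≤ η₀) →
      ∃ d, Near ε c d ∧ ∀ x, χ x = 0 → d.nullPlus x = p x ∧ d.nullMinus x = q x := by
  set I := ∫ x in (0 : ℝ)..L, χ x with hI
  set ρ : ℝ → ℝ := fun x => c.energyDensity x / 2 with hρ
  have hρc : Continuous ρ := c.continuous_energyDensity.div_const 2
  have hρpos : ∀ x, 0 < ρ x := fun x => half_pos (c.energyDensity_pos x)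
  have hρL : Function.Periodic ρ L := fun x => by
    simp only [hρ, periodic_energyDensity hcL hvL x]
  have hcρ : ∀ x, deriv c.curve x = ρ x • (c.nullPlus x - c.nullMinus x) := fun x => by
    rw [c.nullPlus_sub_nullMinus, smul_smul, c.deriv_curve_eq]
    congr 1
    simp only [hρ]; ring
  obtain ⟨_, M, _, hM, hρM⟩ := exists_pos_le_of_periodic hL hρc hρL hρpos
  obtain ⟨m, _, hm, _, hcm⟩ := exists_pos_le_of_periodic (f := fun x => ‖deriv c.curve x‖) hL
    c.continuous_deriv_curve.norm (fun x => by simp only [c.periodic_deriv hcL x])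
    (fun x => norm_pos_iff.2 (c.immersion x))
  set C := 2 * M + 4 * (I⁻¹ * (2 * M * L)) with hC
  obtain ⟨η, hη1, hη2, hη3, hη5, hη0⟩ : ∃ η : ℝ, C * η < ε ∧ C * L * η < ε ∧
      C * η < m / 2 ∧ (1 + 2 * C / m) * η < ε ∧ 0 < η :=
    ((eventually_mul_lt C hε).and
      ((eventually_mul_lt (C * L) hε).and ((eventually_mul_lt C (half_pos hm)).and
      ((eventually_mul_lt (1 + 2 * C / m) hε).and self_mem_nhdsWithin)))).exists
  refine ⟨η, hη0, fun p q hpcont hqcont hpper hqper hp1 hq1 hpp hqq => ?_⟩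
  have hpq : ∀ x, ‖ρ x • (p x - q x) - deriv c.curve x‖ ≤ 2 * M * η := fun x => by
    rw [hcρ, ← smul_sub, norm_smul, Real.norm_eq_abs, abs_of_pos (hρpos x)]
    have h1 : ‖p x - q x - (c.nullPlus x - c.nullMinus x)‖ ≤ 2 * η := by
      rw [show p x - q x - (c.nullPlus x - c.nullMinus x) =
        (p x - c.nullPlus x) - (q x - c.nullMinus x) by abel]
      refine (norm_sub_le _ _).trans ?_
      linarith [hpp x, hqq x]
    calc ρ x * _ ≤ M * (2 * η) := mul_le_mul (hρM x).2 h1 (norm_nonneg _) hM.le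
      _ = 2 * M * η := by ring
  -- the correction which restores the periodicity of the curve
  set κ : Space n := I⁻¹ • ∫ x in (0 : ℝ)..L, ρ x • (p x - q x) with hκ
  have hκn : ‖κ‖ ≤ I⁻¹ * (2 * M * L) * η := by
    have h0 : ∫ x in (0 : ℝ)..L, deriv c.curve x = 0 := by
      rw [intervalIntegral.integral_eq_sub_of_hasDerivAt (fun x _ => c.hasDerivAt_curve x)
        (c.continuous_deriv_curve.intervalIntegrable _ _)]
      have := hcL 0
      rw [zero_add] at this
      rw [this, sub_self]
    have h1 : ‖(∫ x in (0 : ℝ)..L, ρ x • (p x - q x)) - ∫ x in (0 : ℝ)..L, deriv c.curve x‖ ≤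
        2 * M * η * |L - 0| := by
      rw [← intervalIntegral.integral_sub ((by fun_prop : Continuous
        fun x => ρ x • (p x - q x)).intervalIntegrable _ _)
        (c.continuous_deriv_curve.intervalIntegrable _ _)]
      exact intervalIntegral.norm_integral_le_of_norm_le_const fun x _ => hpq x
    rw [h0, sub_zero, sub_zero, abs_of_pos hL] at h1
    rw [hκ, norm_smul, Real.norm_eq_abs, abs_of_pos (inv_pos.2 hχI), mul_assoc]
    refine mul_le_mul_of_nonneg_left (h1.trans_eq (by ring)) (inv_pos.2 hχI).le
  have hχκ : ∀ x, ‖χ x • κ‖ ≤ 4 * (I⁻¹ * (2 * M * L)) * η := fun x => by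
    rw [norm_smul, Real.norm_eq_abs, abs_of_nonneg (hχ0 x), mul_assoc]
    exact mul_le_mul (hχ4 x) hκn (norm_nonneg _) (by norm_num)
  set g : ℝ → Space n := fun x => ρ x • (p x - q x) - χ x • κ with hg
  have hgc : Continuous g := by fun_prop
  have hgL : Function.Periodic g L := fun x => by
    simp only [hg, hρL x, hpper x, hqper x, hχL x]
  have hgn : ∀ x, ‖g x - deriv c.curve x‖ ≤ C * η := fun x => by
    rw [show g x - deriv c.curve x = (ρ x • (p x - q x) - deriv c.curve x) - χ x • κ by
      simp only [hg]; abel]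
    refine (norm_sub_le _ _).trans ?_
    rw [hC, add_mul]
    exact add_le_add (hpq x) (hχκ x)
  have hgm : ∀ x, m / 2 ≤ ‖g x‖ := fun x => by
    have h1 := norm_sub_norm_le (deriv c.curve x) (g x)
    have h2 := hgn x
    rw [norm_sub_rev] at h2
    linarith [(hcm x).1]
  have hg0 : ∀ x, g x ≠ 0 := fun x => norm_pos_iff.1 ((half_pos hm).trans_le (hgm x))
  have hgint : ∫ x in (0 : ℝ)..L, g x = 0 := by
    rw [intervalIntegral.integral_sub ((by fun_prop : Continuous
        fun x => ρ x • (p x - q x)).intervalIntegrable _ _)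
        ((by fun_prop : Continuous fun x => χ x • κ).intervalIntegrable _ _),
      intervalIntegral.integral_smul_const, hκ, smul_smul, mul_inv_cancel₀ hχI.ne', one_smul,
      sub_self]
  have hpq_ne : ∀ x, p x ≠ q x := fun x h => by
    have h1 := hpq x
    rw [h, sub_self, smul_zero, zero_sub, norm_neg] at h1
    have h2 : 0 ≤ 4 * (I⁻¹ * (2 * M * L)) * η := by positivity
    have h3 : C * η = 2 * M * η + 4 * (I⁻¹ * (2 * M * L)) * η := by rw [hC]; ring
    linarith [(hcm x).1]
  -- the velocity, made orthogonal to the corrected curve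
  set w₁ : ℝ → Space n := fun x => (2 : ℝ)⁻¹ • (p x + q x) with hw₁
  have hw₁c : Continuous w₁ := by fun_prop
  have hw₁n : ∀ x, ‖w₁ x‖ < 1 := fun x => by
    have h1 := parallelogram_law_with_norm ℝ (p x) (q x)
    have h2 : 0 < ‖p x - q x‖ := norm_pos_iff.2 (sub_ne_zero.2 (hpq_ne x))
    rw [hp1, hq1] at h1
    simp only [hw₁, norm_smul]
    norm_num
    nlinarith [norm_nonneg (p x + q x)]
  have hw₁g : ∀ x, inner ℝ (w₁ x) (g x) = -inner ℝ (w₁ x) (χ x • κ) := fun x => by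
    have h1 : inner ℝ (w₁ x) (ρ x • (p x - q x)) = 0 := by
      simp only [hw₁, inner_sub_right, inner_smul_left, inner_smul_right, inner_add_left,
        real_inner_self_eq_norm_sq, hp1, hq1, real_inner_comm (p x) (q x)]
      ring
    simp only [hg]
    rw [inner_sub_right, h1, zero_sub]
  set w : ℝ → Space n := fun x => w₁ x - (inner ℝ (w₁ x) (g x) / ‖g x‖ ^ 2) • g x with hw
  have hwc : Continuous w := by
    have h1 : Continuous fun x => inner ℝ (w₁ x) (g x) / ‖g x‖ ^ 2 :=
      (hw₁c.inner hgc).div (by fun_prop) fun x => pow_ne_zero 2 (norm_ne_zero_iff.2 (hg0 x))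
    fun_prop
  have hwL : Function.Periodic w L := fun x => by
    simp only [hw, hw₁, hgL x, hpper x, hqper x]
  have hwg : ∀ x, inner ℝ (w x) (g x) = 0 := fun x => by
    have := norm_ne_zero_iff.2 (hg0 x)
    simp only [hw, inner_sub_left, inner_smul_left, real_inner_self_eq_norm_sq, conj_trivial]
    field_simp
    ring
  have hwn : ∀ x, ‖w x‖ < 1 := fun x => by
    have h1 : ‖w₁ x‖ ^ 2 = ‖w x‖ ^ 2 + ‖(inner ℝ (w₁ x) (g x) / ‖g x‖ ^ 2) • g x‖ ^ 2 := by
      have h2 : w₁ x = w x + (inner ℝ (w₁ x) (g x) / ‖g x‖ ^ 2) • g x := by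
        simp only [hw]; abel
      conv_lhs => rw [h2]
      rw [norm_add_sq_real, inner_smul_right, hwg]
      ring
    have h3 := hw₁n x
    nlinarith [norm_nonneg (w x), norm_nonneg (w₁ x),
      sq_nonneg ‖(inner ℝ (w₁ x) (g x) / ‖g x‖ ^ 2) • g x‖]
  have hwv : ∀ x, ‖w x - c.velocity x‖ < ε := fun x => by
    have h1 : ‖w₁ x - c.velocity x‖ ≤ η := by
      have h2 : w₁ x - c.velocity x =
          (2 : ℝ)⁻¹ • ((p x - c.nullPlus x) + (q x - c.nullMinus x)) := by
        have := c.nullPlus_add_nullMinus x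
        rw [show p x - c.nullPlus x + (q x - c.nullMinus x) =
          (p x + q x) - (c.nullPlus x + c.nullMinus x) by abel, this, smul_sub, smul_smul]
        norm_num [hw₁]
      rw [h2, norm_smul, norm_inv, Real.norm_ofNat]
      have := norm_add_le (p x - c.nullPlus x) (q x - c.nullMinus x)
      linarith [hpp x, hqq x]
    have h3 : ‖(inner ℝ (w₁ x) (g x) / ‖g x‖ ^ 2) • g x‖ ≤ 2 * C / m * η := by
      have hgp := (half_pos hm).trans_le (hgm x)
      have h4 : |inner ℝ (w₁ x) (g x)| ≤ C * η := by
        rw [hw₁g, abs_neg]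
        refine (abs_real_inner_le_norm _ _).trans ?_
        have h5 : ‖w₁ x‖ * ‖χ x • κ‖ ≤ 1 * (4 * (I⁻¹ * (2 * M * L)) * η) :=
          mul_le_mul (hw₁n x).le (hχκ x) (norm_nonneg _) zero_le_one
        have h6 : 0 ≤ 2 * M * η := by positivity
        rw [hC, add_mul]
        linarith
      rw [norm_smul, Real.norm_eq_abs, abs_div, abs_of_pos (pow_pos hgp 2)]
      rw [show |inner ℝ (w₁ x) (g x)| / ‖g x‖ ^ 2 * ‖g x‖ = |inner ℝ (w₁ x) (g x)| / ‖g x‖ by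
        field_simp]
      calc _ ≤ (C * η) / (m / 2) :=
            div_le_div₀ ((abs_nonneg _).trans h4) h4 (half_pos hm) (hgm x)
        _ = 2 * C / m * η := by field_simp
    rw [show w x - c.velocity x = (w₁ x - c.velocity x) -
      (inner ℝ (w₁ x) (g x) / ‖g x‖ ^ 2) • g x by simp only [hw]; abel]
    refine (norm_sub_le _ _).trans_lt ?_
    linarith
  obtain ⟨d, hd0, hdg, hdw, hdL⟩ := exists_of_deriv (c.curve 0) hL hgc hwc hgL hwL hg0 hwg hwn hgint
  refine ⟨d, near_of_deriv hL hcL hdL hd0 (δ := C * η) (fun x => by rw [hdg]; exact hgn x) hη1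
    (by linarith) (fun x => by rw [hdw]; exact hwv x), ?_⟩
  intro x hx
  refine null_eq_of_unit (hp1 x) (hq1 x) (hpq_ne x) (hρpos x) ?_ ?_
  · rw [hdg]; simp [hg, hx]
  · have h0 : inner ℝ (w₁ x) (g x) = 0 := by rw [hw₁g, hx]; simp
    rw [hdw]
    change w₁ x - (inner ℝ (w₁ x) (g x) / ‖g x‖ ^ 2) • g x = w₁ x
    rw [h0, zero_div, zero_smul, sub_zero]

/-- Two curves which near `x₀` and `y₀` are bent along the orthogonal great circles through `e` with
directions `f₁` and `f₂` cross stably. -/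
theorem meetStably_of_bend {e f₁ f₂ : Space 3} (ho : Orthonormal ℝ ![e, f₁, f₂])
    {P Q p q : ℝ → Space 3} {x₀ y₀ η ω : ℝ} (hη0 : 0 < η) (hη4 : η < 1 / 4) (hω : 0 < ω)
    (hp1 : ∀ x, ‖p x‖ = 1) (hq1 : ∀ x, ‖q x‖ = 1)
    (hx : ∀ᶠ x in 𝓝 x₀, P x = bend η e f₁ (Real.sin (ω * (x - x₀))) (p x) ∧ ‖p x - e‖ ≤ η)
    (hy : ∀ᶠ y in 𝓝 y₀, Q y = bend η e f₂ (Real.sin (ω * (y - y₀))) (q y) ∧ ‖q y - e‖ ≤ η) :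
    MeetStably P Q := by
  have he1 : ‖e‖ = 1 := by simpa using ho.1 0
  have hf₁ : ‖f₁‖ = 1 := by simpa using ho.1 1
  have hf₂ : ‖f₂‖ = 1 := by simpa using ho.1 2
  have he₁ : inner ℝ e f₁ = 0 := by simpa using ho.2 (show (0 : Fin 3) ≠ 1 by decide)
  have he₂ : inner ℝ e f₂ = 0 := by simpa using ho.2 (show (0 : Fin 3) ≠ 2 by decide)
  have h₁₂ : inner ℝ f₁ f₂ = 0 := by simpa using ho.2 (show (1 : Fin 3) ≠ 2 by decide)
  have hs₁ : inner ℝ f₁ e = 0 := by rw [real_inner_comm, he₁]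
  have hs₂ : inner ℝ f₂ e = 0 := by rw [real_inner_comm, he₂]
  have h₂₁ : inner ℝ f₂ f₁ = 0 := by rw [real_inner_comm, h₁₂]
  have hsin : ∀ a x, |Real.sin (ω * (x - a))| ≤ 1 := fun a x => Real.abs_sin_le_one _
  obtain ⟨r₁, hr₁, hball₁⟩ := Metric.eventually_nhds_iff_ball.1 hx
  obtain ⟨r₂, hr₂, hball₂⟩ := Metric.eventually_nhds_iff_ball.1 hy
  set r := min (min r₁ r₂ / 2) (1 / ω) with hr
  have hr0 : 0 < r := lt_min (half_pos (lt_min hr₁ hr₂)) (by positivity)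
  have hrr₁ : r < r₁ := by
    have h1 : r ≤ min r₁ r₂ / 2 := min_le_left _ _
    have h2 := min_le_left r₁ r₂
    linarith
  have hrr₂ : r < r₂ := by
    have h1 : r ≤ min r₁ r₂ / 2 := min_le_left _ _
    have h2 := min_le_right r₁ r₂
    linarith
  have hωr : 0 < Real.sin (ω * r) := by
    refine Real.sin_pos_of_pos_of_lt_pi (by positivity) ?_
    have h1 : ω * r ≤ ω * (1 / ω) := mul_le_mul_of_nonneg_left (min_le_right _ _) hω.le
    have h2 : ω * (1 / ω) = 1 := by field_simp
    linarith [Real.pi_gt_three]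
  have hxI : ∀ x ∈ Icc (x₀ - r) (x₀ + r), ∃ N : ℝ, 1 / 2 ≤ N ∧
      P x = N • (e + (η * Real.sin (ω * (x - x₀))) • f₁) := fun x hx => by
    obtain ⟨h1, h2⟩ := hball₁ x (by
      rw [Metric.mem_ball, Real.dist_eq, abs_lt]; constructor <;> linarith [hx.1, hx.2])
    obtain ⟨N, hN, h⟩ := exists_bend_eq hη0 hη4 he1 hf₁ (hsin x₀ x) (hp1 x) h2
    exact ⟨N, hN, h1.trans h⟩
  have hyI : ∀ y ∈ Icc (y₀ - r) (y₀ + r), ∃ N : ℝ, 1 / 2 ≤ N ∧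
      Q y = N • (e + (η * Real.sin (ω * (y - y₀))) • f₂) := fun y hy => by
    obtain ⟨h1, h2⟩ := hball₂ y (by
      rw [Metric.mem_ball, Real.dist_eq, abs_lt]; constructor <;> linarith [hy.1, hy.2])
    obtain ⟨N, hN, h⟩ := exists_bend_eq hη0 hη4 he1 hf₂ (hsin y₀ y) (hq1 y) h2
    exact ⟨N, hN, h1.trans h⟩
  have hx_left : x₀ - r ∈ Icc (x₀ - r) (x₀ + r) := ⟨le_rfl, by linarith⟩
  have hx_right : x₀ + r ∈ Icc (x₀ - r) (x₀ + r) := ⟨by linarith, le_rfl⟩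
  have hy_left : y₀ - r ∈ Icc (y₀ - r) (y₀ + r) := ⟨le_rfl, by linarith⟩
  have hy_right : y₀ + r ∈ Icc (y₀ - r) (y₀ + r) := ⟨by linarith, le_rfl⟩
  have hsin1 := Real.sin_le_one (ω * r)
  have hs : 0 < η * Real.sin (ω * r) := mul_pos hη0 hωr
  have hs2 : η * Real.sin (ω * r) ≤ 1 := by nlinarith
  refine meetStably_of_crossing ho (a := x₀ - r) (b := x₀ + r) (c := y₀ - r) (d := y₀ + r)
    (η := η * Real.sin (ω * r) / 2) (by linarith) (by linarith) (half_pos hs)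
    (fun x hx => ?_) (fun y hy => ?_) (fun x hx => ?_) (fun y hy => ?_) ?_ ?_ ?_ ?_
  · obtain ⟨N, hN, h⟩ := hxI x hx
    rw [h, inner_smul_right, inner_add_right, inner_smul_right, he₁, real_inner_self_eq_norm_sq,
      he1]
    linarith
  · obtain ⟨N, hN, h⟩ := hyI y hy
    rw [h, inner_smul_right, inner_add_right, inner_smul_right, he₂, real_inner_self_eq_norm_sq,
      he1]
    linarith
  · obtain ⟨N, hN, h⟩ := hxI x hx
    rw [h, inner_smul_right, inner_add_right, inner_smul_right, hs₂, h₂₁]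
    ring
  · obtain ⟨N, hN, h⟩ := hyI y hy
    rw [h, inner_smul_right, inner_add_right, inner_smul_right, hs₁, h₁₂]
    ring
  · obtain ⟨N, hN, h⟩ := hxI _ hx_left
    rw [h, inner_smul_right, inner_add_right, inner_smul_right, hs₁,
      real_inner_self_eq_norm_sq, hf₁, show ω * (x₀ - r - x₀) = -(ω * r) by ring, Real.sin_neg]
    nlinarith
  · obtain ⟨N, hN, h⟩ := hxI _ hx_right
    rw [h, inner_smul_right, inner_add_right, inner_smul_right, hs₁,
      real_inner_self_eq_norm_sq, hf₁, add_sub_cancel_left]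
    nlinarith
  · obtain ⟨N, hN, h⟩ := hyI _ hy_left
    rw [h, inner_smul_right, inner_add_right, inner_smul_right, hs₂,
      real_inner_self_eq_norm_sq, hf₂, show ω * (y₀ - r - y₀) = -(ω * r) by ring, Real.sin_neg]
    nlinarith
  · obtain ⟨N, hN, h⟩ := hyI _ hy_right
    rw [h, inner_smul_right, inner_add_right, inner_smul_right, hs₂,
      real_inner_self_eq_norm_sq, hf₂, add_sub_cancel_left]
    nlinarith

/-- A non-extendable couple can be perturbed so that its null directions meet stably: near
a common value `e` they are replaced by small arcs of great circles through `e`, orthogonal to each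
other. -/
theorem exists_near_meetStably (c : PeriodicCouple 3) {x₀ y₀ : ℝ}
    (hmeet : c.nullPlus x₀ = c.nullMinus y₀) {ε : ℝ} (hε : 0 < ε) :
    ∃ d, Near ε c d ∧ MeetStably d.nullPlus d.nullMinus := by
  obtain ⟨L, hL, hcL, hvL⟩ := c.periodic
  have hpL := periodic_nullPlus hcL hvL
  have hqL := periodic_nullMinus hcL hvL
  have hpc := c.continuous_nullPlus
  have hqc := c.continuous_nullMinus
  set e := c.nullPlus x₀ with he
  -- the directions at `e` of two orthogonal great circles
  obtain ⟨f₁, f₂, ho⟩ := exists_orthonormal_frame (e := e) (c.norm_nullPlus x₀)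
  have hf₁ : ‖f₁‖ = 1 := by simpa using ho.1 1
  have hf₂ : ‖f₂‖ = 1 := by simpa using ho.1 2
  -- `p x₀ ≠ q x₀` keeps `y₀ - x₀` away from the multiples of the period
  obtain ⟨χ, hχc, hχL, hχ0, hχ4, hχx, hχy, hχI⟩ := exists_periodic_cutoff (x₀ := x₀) (y₀ := y₀) hL
    (fun k hk => c.nullPlus_ne_nullMinus x₀ (by
      have := hqL.int_mul (k * 2) x₀
      rw [← this, ← he, hmeet]
      congr 1
      push_cast
      linarith))
  obtain ⟨η₀, hη₀, hex⟩ := c.exists_near_of_null hL hcL hvL hχc hχL hχ0 hχ4 hχI hε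
  obtain ⟨η, hη4, hη1, hη0⟩ : ∃ η : ℝ, 1 * η < 1 / 4 ∧ 4 * η < η₀ ∧ 0 < η :=
    ((eventually_mul_lt 1 (by norm_num)).and ((eventually_mul_lt 4 hη₀).and
      self_mem_nhdsWithin)).exists
  rw [one_mul] at hη4
  set ω := 2 * Real.pi / L with hω
  have hωL : ω * L = 2 * Real.pi := by rw [hω]; field_simp
  have hωpos : 0 < ω := by positivity
  have hsin : ∀ a x, |Real.sin (ω * (x - a))| ≤ 1 := fun a x => Real.abs_sin_le_one _
  have hsinL : ∀ a, Function.Periodic (fun x => Real.sin (ω * (x - a))) L := fun a x => by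
    simp only
    rw [show ω * (x + L - a) = ω * (x - a) + ω * L by ring, hωL, Real.sin_add_two_pi]
  -- the perturbed null directions
  set p : ℝ → Space 3 := fun x => bend η e f₁ (Real.sin (ω * (x - x₀))) (c.nullPlus x) with hp
  set q : ℝ → Space 3 := fun y => bend η e f₂ (Real.sin (ω * (y - y₀))) (c.nullMinus y) with hq
  have hp1 : ∀ x, ‖p x‖ = 1 := fun x => norm_bend hη0 hη4 hf₁ (hsin _ x) (c.norm_nullPlus x)
  have hq1 : ∀ x, ‖q x‖ = 1 := fun x => norm_bend hη0 hη4 hf₂ (hsin _ x) (c.norm_nullMinus x)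
  have hpp : ∀ x, ‖p x - c.nullPlus x‖ ≤ η₀ := fun x =>
    (norm_bend_sub_le hη0 hη4 hf₁ (hsin _ x) (c.norm_nullPlus x)).trans hη1.le
  have hqq : ∀ x, ‖q x - c.nullMinus x‖ ≤ η₀ := fun x =>
    (norm_bend_sub_le hη0 hη4 hf₂ (hsin _ x) (c.norm_nullMinus x)).trans hη1.le
  have hpcont : Continuous p :=
    continuous_bend hη0 hη4 hf₁ hpc (by fun_prop) (hsin _) c.norm_nullPlus
  have hqcont : Continuous q :=
    continuous_bend hη0 hη4 hf₂ hqc (by fun_prop) (hsin _) c.norm_nullMinus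
  have hpper : Function.Periodic p L := fun x => by
    have := hsinL x₀ x
    simp only [hp] at this ⊢
    rw [this, hpL x]
  have hqper : Function.Periodic q L := fun x => by
    have := hsinL y₀ x
    simp only [hq] at this ⊢
    rw [this, hqL x]
  obtain ⟨d, hd, hnull⟩ := hex p q hpcont hqcont hpper hqper hp1 hq1 hpp hqq
  refine ⟨d, hd, meetStably_of_bend (e := e) (x₀ := x₀) (y₀ := y₀) ho hη0 hη4 hωpos
    c.norm_nullPlus c.norm_nullMinus ?_ ?_⟩
  · have hlt : ∀ᶠ x in 𝓝 x₀, ‖c.nullPlus x - e‖ < η :=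
      (by fun_prop : ContinuousAt (fun x => ‖c.nullPlus x - e‖) x₀).eventually_lt
        continuousAt_const (by rw [he, sub_self, norm_zero]; exact hη0)
    filter_upwards [hχx, hlt] with x h1 h2
    exact ⟨(hnull x h1).1, h2.le⟩
  · have hlt : ∀ᶠ x in 𝓝 y₀, ‖c.nullMinus x - e‖ < η :=
      (by fun_prop : ContinuousAt (fun x => ‖c.nullMinus x - e‖) y₀).eventually_lt
        continuousAt_const (by rw [hmeet, sub_self, norm_zero]; exact hη0)
    filter_upwards [hχy, hlt] with x h1 h2
    exact ⟨(hnull x h1).2, h2.le⟩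

/-- The non-extendable couples are limits of interior points. -/
theorem subset_closure_interior_nonextendable :
    {c : PeriodicCouple 3 | ¬ c.Extendable} ⊆
      closure (interior {c : PeriodicCouple 3 | ¬ c.Extendable}) := by
  intro c hc
  have hc' : ∃ x y, c.nullPlus x = c.nullMinus y := by
    by_contra! h
    exact hc (c.extendable_iff.2 h)
  obtain ⟨x, y, hxy⟩ := hc'
  rw [mem_closure_iff]
  intro o ho hco
  obtain ⟨ε, hε, hsub⟩ := exists_near_subset ho hco
  obtain ⟨d, hd, hdm⟩ := c.exists_near_meetStably hxy hε
  exact ⟨d, hsub d hd, interior_maximal (fun _ h => not_extendable_of_meetStably h)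
    isOpen_meetStably hdm⟩

end PeriodicCouple

/-! ### Examples -/

namespace PeriodicCouple

theorem hasDerivAt_vec {f g h : ℝ → ℝ} {f' g' h' x : ℝ} (hf : HasDerivAt f f' x)
    (hg : HasDerivAt g g' x) (hh : HasDerivAt h h' x) :
    HasDerivAt (fun x => (!₂[f x, g x, h x] : Space 3)) !₂[f', g', h'] x := by
  refine ((PiLp.continuousLinearEquiv 2 ℝ fun _ : Fin 3 => ℝ).symm.hasFDerivAt.comp_hasDerivAt x
    (hasDerivAt_pi.2 fun i => ?_ : HasDerivAt (fun x => ![f x, g x, h x]) ![f', g', h'] x))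
  fin_cases i <;> simpa

theorem continuous_vec {f g h : ℝ → ℝ} (hf : Continuous f) (hg : Continuous g)
    (hh : Continuous h) : Continuous fun x => (!₂[f x, g x, h x] : Space 3) := by
  refine (PiLp.continuous_toLp 2 _).comp (continuous_pi fun i => ?_)
  fin_cases i <;> simpa

/-- The null directions of the couple are `p = ((1 - u²), 2u, 0) / (1 + u²)` and
`q = (-(1 - u²), 0, 2u) / (1 + u²)`, where `u = √2 sin x`. They describe arcs of two orthogonal great
circles which do not meet. The factor `√2` in `u` makes `(1 + u²) (p - q)`, the derivative of the
curve, of mean zero. -/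
theorem exists_extendable : ∃ c : PeriodicCouple 3, c.Extendable := by
  set u : ℝ → ℝ := fun x => √2 * Real.sin x with hu
  have huc : Continuous u := by fun_prop
  have hpos : ∀ x, 0 < 1 + u x ^ 2 := fun x => by positivity
  set p : ℝ → Space 3 := fun x =>
    (1 + u x ^ 2)⁻¹ • !₂[1 - u x ^ 2, 2 * u x, 0] with hp
  set q : ℝ → Space 3 := fun x =>
    (1 + u x ^ 2)⁻¹ • !₂[-(1 - u x ^ 2), 0, 2 * u x] with hq
  have hp1 : ∀ x, ‖p x‖ = 1 := fun x => by
    rw [← sq_eq_sq₀ (norm_nonneg _) zero_le_one, EuclideanSpace.real_norm_sq_eq]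
    have := (hpos x).ne'
    simp [hp, Fin.sum_univ_three]
    field_simp
    ring
  have hq1 : ∀ x, ‖q x‖ = 1 := fun x => by
    rw [← sq_eq_sq₀ (norm_nonneg _) zero_le_one, EuclideanSpace.real_norm_sq_eq]
    have := (hpos x).ne'
    simp [hq, Fin.sum_univ_three]
    field_simp
    ring
  have hne : ∀ x y, p x ≠ q y := fun x y h => by
    have h2 : (p x) 2 = (q y) 2 := by rw [h]
    have h0 : (p x) 0 = (q y) 0 := by rw [h]
    have hx := (hpos x).ne'
    have hy := (hpos y).ne'
    have h3 : u y = 0 := by simpa [hp, hq, hy] using h2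
    simp only [hp, hq, h3, PiLp.smul_apply, smul_eq_mul] at h0
    field_simp at h0
    simp at h0
    linarith
  have hsub : ∀ x, (1 + u x ^ 2) • (p x - q x) =
      !₂[2 * (1 - u x ^ 2), 2 * u x, -(2 * u x)] := fun x => by
    have := (hpos x).ne'
    ext i
    fin_cases i <;> simp [hp, hq] <;> field_simp
    ring
  have hper : ∀ x, u (x + 2 * Real.pi) = u x := fun x => by simp only [hu, Real.sin_add_two_pi]
  have hpper : ∀ x, p (x + 2 * Real.pi) = p x := fun x => by simp only [hp, hper x]
  have hqper : ∀ x, q (x + 2 * Real.pi) = q x := fun x => by simp only [hq, hper x]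
  have hpc : Continuous p :=
    ((by fun_prop : Continuous fun x => 1 + u x ^ 2).inv₀ fun x => (hpos x).ne').smul
      (continuous_vec (by fun_prop) (by fun_prop) (by fun_prop))
  have hqc : Continuous q :=
    ((by fun_prop : Continuous fun x => 1 + u x ^ 2).inv₀ fun x => (hpos x).ne').smul
      (continuous_vec (by fun_prop) (by fun_prop) (by fun_prop))
  have hint : ∫ x in (0 : ℝ)..(2 * Real.pi), (1 + u x ^ 2) • (p x - q x) = 0 := by
    rw [intervalIntegral.integral_eq_sub_of_hasDerivAt (f := fun x =>
      !₂[Real.sin (2 * x), 2 * √2 * -Real.cos x, -(2 * √2 * -Real.cos x)]) (fun x _ => ?_)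
      (Continuous.intervalIntegrable (by fun_prop) _ _)]
    · simp [Real.sin_two_mul]
    · rw [hsub]
      have h1 : HasDerivAt (fun x => 2 * √2 * -Real.cos x) (2 * u x) x :=
        ((Real.hasDerivAt_cos x).neg.const_mul _).congr_deriv (by simp only [hu]; ring)
      refine hasDerivAt_vec ?_ h1 h1.neg
      refine ((Real.hasDerivAt_sin (2 * x)).comp x ((hasDerivAt_id x).const_mul 2)).congr_deriv ?_
      simp only [hu]
      rw [Real.cos_two_mul', mul_pow, Real.sq_sqrt (by norm_num)]
      nlinarith [Real.sin_sq_add_cos_sq x]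
  obtain ⟨d, -, hd, hv, -⟩ := exists_of_deriv (n := 3) 0 Real.two_pi_pos
    (g := fun x => (1 + u x ^ 2) • (p x - q x)) (w := fun x => (2 : ℝ)⁻¹ • (p x + q x))
    (by fun_prop) (by fun_prop) (fun x => by simp only [hper x, hpper x, hqper x])
    (fun x => by simp only [hpper x, hqper x])
    (fun x => smul_ne_zero (hpos x).ne' (sub_ne_zero.2 (hne x x)))
    (fun x => by
      simp only [inner_sub_right, inner_smul_left, inner_smul_right, inner_add_left,
        real_inner_self_eq_norm_sq, hp1, hq1, real_inner_comm (p x) (q x)]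
      ring)
    (fun x => by
      have h1 := parallelogram_law_with_norm ℝ (p x) (q x)
      have h2 : 0 < ‖p x - q x‖ := norm_pos_iff.2 (sub_ne_zero.2 (hne x x))
      rw [hp1, hq1] at h1
      rw [norm_smul]
      norm_num
      nlinarith [norm_nonneg (p x + q x)]) hint
  have hnull : ∀ x, d.nullPlus x = p x ∧ d.nullMinus x = q x := fun x =>
    null_eq_of_unit (hp1 x) (hq1 x) (hne x x) (hpos x) (by rw [hd]) (by rw [hv])
  refine ⟨d, d.extendable_iff.2 fun x y => ?_⟩
  rw [(hnull x).1, (hnull y).2]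
  exact hne x y

/-- A circle at rest is not extendable: the circular cylinder which it spans collapses to a point. -/
theorem exists_not_extendable : ∃ c : PeriodicCouple 3, ¬ c.Extendable := by
  have hd : ∀ x, HasDerivAt (fun x => (!₂[Real.cos x, Real.sin x, 0] : Space 3))
      !₂[-Real.sin x, Real.cos x, 0] x := fun x =>
    hasDerivAt_vec (Real.hasDerivAt_cos x) (Real.hasDerivAt_sin x) (hasDerivAt_const x 0)
  set p : ℝ → Space 3 := fun x => !₂[-Real.sin x, Real.cos x, 0] with hp
  have hp1 : ∀ x, ‖p x‖ = 1 := fun x => by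
    rw [← sq_eq_sq₀ (norm_nonneg _) zero_le_one, EuclideanSpace.real_norm_sq_eq]
    simp [hp, Fin.sum_univ_three]
  have hp0 : ∀ x, p x ≠ 0 := fun x => norm_ne_zero_iff.1 (by rw [hp1]; exact one_ne_zero)
  have hpc : Continuous p := continuous_vec (by fun_prop) (by fun_prop) (by fun_prop)
  have hper : ∀ x, p (x + 2 * Real.pi) = p x := fun x => by
    simp only [hp, Real.sin_add_two_pi, Real.cos_add_two_pi]
  obtain ⟨d, -, hd, hv, -⟩ := exists_of_deriv (n := 3) 0 Real.two_pi_pos (g := p) (w := fun _ => 0)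
    hpc continuous_const hper (fun _ => rfl) hp0 (fun x => inner_zero_left _) (fun x => by simp) (by
      rw [intervalIntegral.integral_eq_sub_of_hasDerivAt (fun x _ => hd x)
        (hpc.intervalIntegrable _ _)]
      simp)
  have hnull : ∀ x, d.nullPlus x = p x ∧ d.nullMinus x = -p x := fun x =>
    null_eq_of_unit (r := 2⁻¹) (hp1 x) (by rw [norm_neg, hp1])
      (fun h => hp0 x (by
        have h1 : (2 : ℝ) • p x = 0 := by rw [two_smul]; nth_rw 1 [h]; exact neg_add_cancel _
        exact (smul_eq_zero.1 h1).resolve_left two_ne_zero)) (by norm_num)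
      (by rw [hd, sub_neg_eq_add, ← two_smul ℝ, smul_smul]; norm_num) (by rw [hv]; simp)
  refine ⟨d, fun h => d.extendable_iff.1 h 0 Real.pi ?_⟩
  rw [(hnull 0).1, (hnull Real.pi).2]
  ext i
  fin_cases i <;> simp [hp]

end PeriodicCouple

end ExtremalCylinder

end

theorem corollary3p3 :
    -- extendability is stable under small perturbations
    (∀ c : ExtremalCylinder.PeriodicCouple 3, c.Extendable → ∀ᶠ d in 𝓝 c, d.Extendable) ∧
    -- generically, so is non-extendability
    (∃ S : Set (ExtremalCylinder.PeriodicCouple 3),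
      S ⊆ {c | ¬ c.Extendable} ∧ IsClosed S ∧ interior S = ∅ ∧
      {c | ¬ c.Extendable} ⊆ closure ({c | ¬ c.Extendable} \ S) ∧
      ∀ c : ExtremalCylinder.PeriodicCouple 3, ¬ c.Extendable → c ∉ S →
        ∀ᶠ d in 𝓝 c, ¬ d.Extendable) ∧
    -- both behaviours occur on sets with nonempty interior
    (interior {c : ExtremalCylinder.PeriodicCouple 3 | c.Extendable}).Nonempty ∧
    (interior {c : ExtremalCylinder.PeriodicCouple 3 | ¬ c.Extendable}).Nonempty := by
  refine ⟨fun c hc => ExtremalCylinder.PeriodicCouple.isOpen_extendable.mem_nhds hc, ?_, ?_, ?_⟩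
  · -- the exceptional set consists of the non-extendable couples which are not interior
    set N := {c : ExtremalCylinder.PeriodicCouple 3 | ¬ c.Extendable} with hN
    have hsub : N ⊆ closure (interior N) :=
      ExtremalCylinder.PeriodicCouple.subset_closure_interior_nonextendable
    refine ⟨N \ interior N, sdiff_subset, ?_, ?_, ?_, fun c hc hcS => ?_⟩
    · exact ExtremalCylinder.PeriodicCouple.isOpen_extendable.isClosed_compl.sdiff isOpen_interior
    · refine eq_empty_of_forall_notMem fun c hc => (interior_subset hc).2 ?_
      exact interior_mono sdiff_subset hc
    · rwa [sdiff_sdiff_cancel_left interior_subset]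
    · have hcN : c ∈ interior N := by
        by_contra h
        exact hcS ⟨hc, h⟩
      exact mem_interior_iff_mem_nhds.1 hcN
  · rw [ExtremalCylinder.PeriodicCouple.isOpen_extendable.interior_eq]
    exact ExtremalCylinder.PeriodicCouple.exists_extendable
  · obtain ⟨c, hc⟩ := ExtremalCylinder.PeriodicCouple.exists_not_extendable
    exact closure_nonempty_iff.1
      ⟨c, ExtremalCylinder.PeriodicCouple.subset_closure_interior_nonextendable hc⟩
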